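/- **Model.** Let $N$ be even, $p_1,p_2>0$, $\kappa,\gamma\ge 0$ with $\max(p_1,p_2)+\kappa\le 1$; all four parameters may depend on $N$. The vertex set $\{1,\dots,N\}$ is split into two communities of size $N/2$, and $\sigma\in\{\pm1/\sqrt N\}^N$ is the normalized community vector. Let $X_1,\dots,X_N$ be i.i.d. $\mathcal N(0,I_2)$ latent (unobserved) points. Conditionally on them, the edges of a simple graph on the vertices are independent, and $i\ne j$ are joined with probability $\kappa e^{-\gamma\|X_i-X_j\|^2}+r_{ij}$, where $r_{ij}=p_1$ if $i,j$ are in the same community and $r_{ij}=p_2$ otherwise. Let $A$ be the adjacency matrix, $\lambda_1=N\frac{p_1+p_2}{2}$, $\lambda_2=N\frac{p_1-p_2}{2}$, $v_1=\frac1{\sqrt N}(1,\dots,1)^\top$, and let $\mu_1$ be the largest eigenvalue of the matrix $P_1$ with zero diagonal and off-diagonal entries $\kappa e^{-\gamma\|X_i-X_j\|^2}$. **Assumptions**, as $N\to\infty$: * $(H_1)$ $\gamma\to\infty$ and $\frac1\gamma\frac{N}{\ln N}\to\infty$; * $(H_2)$ there are $0<c,C<1$ such that, for all large $N$, $\lambda_2^{-1}\frac{\kappa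 N}{2\gamma}\in[c,C]$ and $\frac{\lambda_2}{\lambda_1}\in[c,C]$; moreover $\lambda_2/\sqrt{\lambda_1}\to\infty$; * there is $\varepsilon>0$ such that either $\frac{p_1-p_2}{2}\ge\frac{2\kappa}{\gamma}(1+\varepsilon)$ for all large $N$, or $\lambda_2\ge 4\mu_1(1+\varepsilon)$ with probability tending to $1$ (to leading order $\mu_1$ is $\kappa N/(2\gamma)$, so these are two forms of the same condition). **Theorem.** If $\lambda_1=N\frac{p_1+p_2}{2}$ is known, weak recovery of the communities is possible: there is an estimator $\hat x=\hat x_N(A,\lambda_1)$, a function of $N$, $A$ and $\lambda_1$ only, such that for all parameters satisfying the assumptions there is $\delta>0$ such that, for every choice of the two balanced communities for each $N$, with probability tending to $1$, $\hat x\in\{\pm1/\sqrt N\}^N$ and $|\sigma^\top\hat x|\ge\delta$. Moreover, if in addition $\frac{\kappa N}{\gamma\ln N}\to\infty$ (which follows from $(H_1)$ when $\kappa$ is bounded away from $0$), then the spectral estimator has this property: $\hat x=\mathrm{sign}(\tilde x)$, where $\tilde x$ is any normalized eigenvector for the largest eigenvalue of $A-\lambda_1v_1v_1^\top$ and $\mathrm{sign}(x)_i=(2\cdot\mathbf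 1\{x_i\ge0\}-1)/\sqrt N$. -/

import Mathlib

open MeasureTheory ProbabilityTheory Filter Topology

noncomputable section

namespace PerturbedSBM

/-- The parameters of the two-community block model perturbed by a Gaussian geometric graph:
`p₁`, `p₂` are the connection probabilities inside and across the communities, `κ` is the strength
and `γ` the inverse width of the geometric kernel. -/
structure Params where
  p₁ : ℝ
  p₂ : ℝ
  κ : ℝ
  γ : ℝ
  p₁_pos : 0 < p₁
  p₂_pos : 0 < p₂
  κ_nonneg : 0 ≤ κ
  γ_nonneg : 0 ≤ γ
  max_add_le_one : max p₁ p₂ + κ ≤ 1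

/-- `λ₁ = N (p₁ + p₂) / 2`. -/
def lam₁ (N : ℕ) (θ : Params) : ℝ := N * (θ.p₁ + θ.p₂) / 2

/-- `λ₂ = N (p₁ - p₂) / 2`. -/
def lam₂ (N : ℕ) (θ : Params) : ℝ := N * (θ.p₁ - θ.p₂) / 2

/-- The latent positions of the `N` vertices, points of the Euclidean plane. -/
abbrev Positions (N : ℕ) : Type := Fin N → EuclideanSpace ℝ (Fin 2)

/-- The positions are i.i.d. with law `𝒩(0, I₂)`. -/
def positionLaw (N : ℕ) : Measure (Positions N) :=
  Measure.pi fun _ => stdGaussian (EuclideanSpace ℝ (Fin 2))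

/-- The matrix `P₁ = κ P`, where `P i j = exp (-γ ‖X i - X j‖²)` off the diagonal and `P i i = 0`. -/
def geomMatrix {N : ℕ} (θ : Params) (X : Positions N) : Matrix (Fin N) (Fin N) ℝ :=
  Matrix.of fun i j => if i = j then 0 else θ.κ * Real.exp (-θ.γ * ‖X i - X j‖ ^ 2)

/-- The largest eigenvalue of a real symmetric matrix. -/
def topEigenvalue {N : ℕ} (M : Matrix (Fin N) (Fin N) ℝ) : ℝ := sSup (spectrum ℝ M)

/-- The conditional probability, given the positions, that the distinct vertices `i`, `j` are
joined; `c` is the community assignment. -/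
def edgeProb {N : ℕ} (θ : Params) (c : Fin N → Bool) (X : Positions N) (i j : Fin N) : ℝ :=
  geomMatrix θ X i j + if c i = c j then θ.p₁ else θ.p₂

open Classical in
/-- The conditional probability of the graph `G` given the positions: the edges are independent
Bernoulli variables with parameters `edgeProb`. -/
def graphWeight {N : ℕ} (θ : Params) (c : Fin N → Bool) (X : Positions N)
    (G : SimpleGraph (Fin N)) : ℝ :=
  ∏ e : Fin N × Fin N with e.1 < e.2,
    if G.Adj e.1 e.2 then edgeProb θ c X e.1 e.2 else 1 - edgeProb θ c X e.1 e.2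

/-- The joint law of the positions and of the observed graph. -/
def modelLaw {N : ℕ} (θ : Params) (c : Fin N → Bool) :
    Measure (Positions N × SimpleGraph (Fin N)) :=
  ((positionLaw N).prod Measure.count).withDensity
    fun ω => ENNReal.ofReal (graphWeight θ c ω.1 ω.2)

/-- The two communities have the same size. -/
def Balanced {N : ℕ} (c : Fin N → Bool) : Prop :=
  2 * Fintype.card {i // c i = true} = N

/-- The normalized community vector `σ ∈ {± 1 / √N} ^ N`. -/
def communityVec {N : ℕ} (c : Fin N → Bool) : Fin N → ℝ :=
  fun i => (if c i then 1 else -1) / √N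

/-- Membership in `{± 1 / √N} ^ N`. -/
def IsNormalizedSignVec {N : ℕ} (x : Fin N → ℝ) : Prop :=
  ∀ i, x i = 1 / √N ∨ x i = -1 / √N

/-- The sign map, with values in `{± 1 / √N} ^ N`. -/
def signVec {N : ℕ} (x : Fin N → ℝ) : Fin N → ℝ :=
  fun i => (if 0 ≤ x i then 1 else -1) / √N

/-- An estimator of the communities: for every number `N` of vertices, it sees the graph and a real
number (which is going to be the known value of `N (p₁ + p₂) / 2`), and outputs a vector. -/
abbrev Estimator : Type := ∀ N : ℕ, SimpleGraph (Fin N) → ℝ → Fin N → ℝ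

/-- `(H₁)` for `N = 2 n` vertices and parameters `θ n`. -/
def H₁ (θ : ℕ → Params) : Prop :=
  Tendsto (fun n => (θ n).γ) atTop atTop ∧
  Tendsto (fun n => 1 / (θ n).γ * (((2 * n : ℕ) : ℝ) / Real.log ((2 * n : ℕ) : ℝ))) atTop atTop

/-- `(H₂)` for `N = 2 n` vertices and parameters `θ n`. -/
def H₂ (θ : ℕ → Params) : Prop :=
  (∃ a b : ℝ, 0 < a ∧ b < 1 ∧ ∀ᶠ n : ℕ in atTop,
    (lam₂ (2 * n) (θ n))⁻¹ * ((θ n).κ * ((2 * n : ℕ) : ℝ) / (2 * (θ n).γ)) ∈ Set.Icc a b ∧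
    lam₂ (2 * n) (θ n) / lam₁ (2 * n) (θ n) ∈ Set.Icc a b) ∧
  Tendsto (fun n => lam₂ (2 * n) (θ n) / √(lam₁ (2 * n) (θ n))) atTop atTop

/-- The separation condition with constant `ε`, either in its explicit form
`(p₁ - p₂) / 2 ≥ (2 κ / γ) (1 + ε)`, or with probability tending to one as `λ₂ ≥ 4 μ₁ (1 + ε)`,
where `μ₁` is the largest eigenvalue of the random matrix `P₁`. -/
def Separated (θ : ℕ → Params) (ε : ℝ) : Prop :=
  (∀ᶠ n in atTop, ((θ n).p₁ - (θ n).p₂) / 2 ≥ 2 * (θ n).κ / (θ n).γ * (1 + ε)) ∨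
  Tendsto (fun n => positionLaw (2 * n)
    {X | lam₂ (2 * n) (θ n) ≥ 4 * topEigenvalue (geomMatrix (θ n) X) * (1 + ε)}) atTop (𝓝 1)

/-- Weak recovery by the estimator `est`, told the value of `λ₁`, for `N = 2 n` vertices and
parameters `θ n`: its output is a normalized sign vector whose correlation with the community
vector is at least a constant `δ > 0`, with probability tending to one, whatever the two balanced
communities are. -/
def WeaklyRecovers (est : Estimator) (θ : ℕ → Params) : Prop :=
  ∃ δ > 0, ∀ c : ∀ n : ℕ, Fin (2 * n) → Bool, (∀ n, Balanced (c n)) →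
    Tendsto (fun n => modelLaw (θ n) (c n)
      {ω | IsNormalizedSignVec (est (2 * n) ω.2 (lam₁ (2 * n) (θ n))) ∧
        δ ≤ |communityVec (c n) ⬝ᵥ est (2 * n) ω.2 (lam₁ (2 * n) (θ n))|}) atTop (𝓝 1)

open Classical in
/-- The matrix `A - t v₁ v₁ᵀ`, where `A` is the adjacency matrix and
`v₁ = (1 / √N) (1, …, 1)ᵀ`. -/
def shiftedAdj {N : ℕ} (G : SimpleGraph (Fin N)) (t : ℝ) : Matrix (Fin N) (Fin N) ℝ :=
  G.adjMatrix ℝ - t • Matrix.vecMulVec (fun _ => 1 / √N) (fun _ => 1 / √N)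

/-- `x` is an eigenvector of Euclidean norm one of the symmetric matrix `M` for its largest
eigenvalue. -/
def IsTopUnitEigenvector {N : ℕ} (M : Matrix (Fin N) (Fin N) ℝ) (x : Fin N → ℝ) : Prop :=
  x ⬝ᵥ x = 1 ∧ M.mulVec x = topEigenvalue M • x

/-- The estimator outputs the signs of a normalized top eigenvector of `A - t v₁ v₁ᵀ`. -/
def IsSpectralEstimator (est : Estimator) : Prop :=
  ∀ N : ℕ, 0 < N → ∀ (G : SimpleGraph (Fin N)) (t : ℝ),
    ∃ x, IsTopUnitEigenvector (shiftedAdj G t) x ∧ est N G t = signVec x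

end PerturbedSBM

end

noncomputable section

namespace PerturbedSBM

/-! Given the positions, the mean of `A - λ₁ v₁ v₁ᵀ` is `P₁ + λ₂ σ σᵀ - p₁ I` (`quad_shiftedAdj`).
If a unit vector `x` has a quadratic form at least as large as that of `σ`, comparing the two gives
`λ₂ (σᵀx)² ≥ λ₂ - 2 (ρ + τ)`, where `ρ` bounds the form of `P₁` and `τ` that of the noise at `x` and
`σ` (`correlation_of_quad_le`). The separation condition yields `ρ ≤ λ₂ / (4 (1 + η))`, so a noise
that is a small multiple of `λ₂` leaves `(σᵀx)²` above `1 / 2` by a constant. This is the threshold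
above which taking signs keeps a positive correlation (`correlation_signVec`).

The geometric bound (`exists_tendsto_goodPositions`) comes either from Schur's test, the row sums of
`P₁` being at most about `κ N / (2 γ)` by Chernoff and `H₁`, or from the hypothesis on `μ₁`, which
bounds the absolute value of the form because the entries are nonnegative.

The estimators differ in the noise bound that they need. Exhaustive search over sign vectors
compares only sign vectors, so a union bound over `2 ^ N` of them suffices (`noise_quad_sign_le`);
it needs `λ₁ → ∞` but no logarithm. A top eigenvector is arbitrary, so the form of the noise must be
bounded on all vectors (`noise_quad_le`). That bound follows from discrepancy and absolute row sums
through a dyadic decomposition, and it is small compared with `λ₁` as soon as `λ₁` dominates `log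
N`, which the extra hypothesis provides. -/

/-! ### Graphs with independent edges -/

/-- The pairs `i < j` of vertices. -/
def pairs (N : ℕ) : Finset (Fin N × Fin N) := Finset.univ.filter fun e => e.1 < e.2

lemma mem_pairs {N : ℕ} {e : Fin N × Fin N} : e ∈ pairs N ↔ e.1 < e.2 := by simp [pairs]

open Classical in
/-- The probability of `G` when the edges are independent with parameters `p`. -/
def bernoulliWeight {N : ℕ} (p : Fin N → Fin N → ℝ) (G : SimpleGraph (Fin N)) : ℝ :=
  ∏ e ∈ pairs N, if G.Adj e.1 e.2 then p e.1 e.2 else 1 - p e.1 e.2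

/-- The probability of a set of graphs when the edges are independent with parameters `p`. -/
def graphProb {N : ℕ} (p : Fin N → Fin N → ℝ) (S : Set (SimpleGraph (Fin N))) : ℝ :=
  ∑ G, S.indicator (bernoulliWeight p) G

open Classical in
/-- The centred adjacency matrix. -/
def noise {N : ℕ} (p : Fin N → Fin N → ℝ) (G : SimpleGraph (Fin N)) :
    Matrix (Fin N) (Fin N) ℝ :=
  Matrix.of fun i j => if i = j then 0 else (if G.Adj i j then 1 else 0) - p i j

-- A graph is the same thing as a set of pairs `i < j`, so this is the expansion of a product of
-- sums over subsets. It expresses independence of the edges: weights and exponential moments factor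
-- over pairs.
open Classical in
lemma sum_graph_prod {N : ℕ} (f g : Fin N × Fin N → ℝ) :
    ∑ G : SimpleGraph (Fin N), ∏ e ∈ pairs N, (if G.Adj e.1 e.2 then f e else g e) =
      ∏ e ∈ pairs N, (f e + g e) := by
  rw [Finset.prod_add]
  refine Finset.sum_bij' (fun G _ => (pairs N).filter fun e => G.Adj e.1 e.2)
    (fun t _ => SimpleGraph.fromRel fun i j => (i, j) ∈ t) ?_ ?_ ?_ ?_ ?_
  · intro G _
    simp
  · intro t _
    simp
  · intro G _
    ext i j
    simp only [SimpleGraph.fromRel_adj, Finset.mem_filter, mem_pairs]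
    constructor
    · rintro ⟨_, h | h⟩
      · exact h.2
      · exact h.2.symm
    · intro h
      refine ⟨h.ne, ?_⟩
      rcases lt_or_gt_of_ne h.ne with h' | h'
      · exact Or.inl ⟨h', h⟩
      · exact Or.inr ⟨h', h.symm⟩
  · intro t ht
    have ht' : t ⊆ pairs N := by simpa using ht
    ext ⟨i, j⟩
    simp only [SimpleGraph.fromRel_adj, Finset.mem_filter, mem_pairs]
    constructor
    · rintro ⟨h, _, h' | h'⟩
      · exact h'
      · exact absurd (mem_pairs.1 (ht' h')) (not_lt.2 h.le)
    · intro h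
      have := mem_pairs.1 (ht' h)
      exact ⟨this, this.ne, Or.inl h⟩
  · intro G _
    rw [Finset.prod_ite, Finset.filter_not]

/-- The parameters `p` are symmetric and lie in the unit interval. -/
structure IsEdgeProb {N : ℕ} (p : Fin N → Fin N → ℝ) : Prop where
  nonneg : ∀ i j, i ≠ j → 0 ≤ p i j
  le_one : ∀ i j, i ≠ j → p i j ≤ 1
  symm : ∀ i j, p i j = p j i

lemma bernoulliWeight_nonneg {N : ℕ} {p : Fin N → Fin N → ℝ} (hp : IsEdgeProb p)
    (G : SimpleGraph (Fin N)) : 0 ≤ bernoulliWeight p G := by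
  refine Finset.prod_nonneg fun e he => ?_
  have h := (mem_pairs.1 he).ne
  split_ifs
  · exact hp.nonneg _ _ h
  · linarith [hp.le_one _ _ h]

lemma sum_bernoulliWeight {N : ℕ} (p : Fin N → Fin N → ℝ) :
    ∑ G, bernoulliWeight p G = 1 := by
  have := sum_graph_prod (fun e : Fin N × Fin N => p e.1 e.2) (fun e => 1 - p e.1 e.2)
  simp only [add_sub_cancel, Finset.prod_const_one] at this
  exact this

lemma graphProb_nonneg {N : ℕ} {p : Fin N → Fin N → ℝ} (hp : IsEdgeProb p)
    (S : Set (SimpleGraph (Fin N))) : 0 ≤ graphProb p S :=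
  Finset.sum_nonneg fun _ _ => Set.indicator_nonneg (fun _ _ => bernoulliWeight_nonneg hp _) _

lemma graphProb_mono {N : ℕ} {p : Fin N → Fin N → ℝ} (hp : IsEdgeProb p)
    {S T : Set (SimpleGraph (Fin N))} (h : S ⊆ T) : graphProb p S ≤ graphProb p T :=
  Finset.sum_le_sum fun _ _ =>
    Set.indicator_le_indicator_of_subset h (fun _ => bernoulliWeight_nonneg hp _) _

lemma graphProb_compl {N : ℕ} (p : Fin N → Fin N → ℝ) (S : Set (SimpleGraph (Fin N))) :
    graphProb p Sᶜ = 1 - graphProb p S := by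
  rw [eq_sub_iff_add_eq, graphProb, graphProb, ← Finset.sum_add_distrib,
    ← sum_bernoulliWeight p]
  refine Finset.sum_congr rfl fun G _ => ?_
  exact Set.indicator_compl_add_self_apply S _ G

lemma graphProb_biUnion_le {N : ℕ} {p : Fin N → Fin N → ℝ} (hp : IsEdgeProb p) {ι : Type*}
    (s : Finset ι) (S : ι → Set (SimpleGraph (Fin N))) :
    graphProb p {G | ∃ i ∈ s, G ∈ S i} ≤ ∑ i ∈ s, graphProb p (S i) := by
  unfold graphProb
  rw [Finset.sum_comm]
  refine Finset.sum_le_sum fun G _ => ?_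
  have hnn : ∀ i ∈ s, 0 ≤ (S i).indicator (bernoulliWeight p) G := fun i _ =>
    Set.indicator_nonneg (fun _ _ => bernoulliWeight_nonneg hp _) _
  by_cases h : ∃ i ∈ s, G ∈ S i
  · obtain ⟨i, hi, hG⟩ := h
    rw [Set.indicator_of_mem (show G ∈ {G | ∃ i ∈ s, G ∈ S i} from ⟨i, hi, hG⟩)]
    calc bernoulliWeight p G = (S i).indicator (bernoulliWeight p) G := by
          rw [Set.indicator_of_mem hG]
      _ ≤ _ := Finset.single_le_sum hnn hi
  · rw [Set.indicator_of_notMem (show G ∉ {G | ∃ i ∈ s, G ∈ S i} from h)]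
    exact Finset.sum_nonneg hnn

lemma graphProb_union_le {N : ℕ} {p : Fin N → Fin N → ℝ} (hp : IsEdgeProb p)
    (S T : Set (SimpleGraph (Fin N))) :
    graphProb p (S ∪ T) ≤ graphProb p S + graphProb p T := by
  have h := graphProb_biUnion_le hp Finset.univ (fun b : Bool => if b then S else T)
  refine (graphProb_mono hp ?_).trans (h.trans (by simp))
  rintro G (hG | hG)
  · exact ⟨true, Finset.mem_univ _, by simpa using hG⟩
  · exact ⟨false, Finset.mem_univ _, by simpa using hG⟩

lemma exp_le_one_add_add_sq {u : ℝ} (h : |u| ≤ 1) : Real.exp u ≤ 1 + u + u ^ 2 := by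
  have := Real.abs_exp_sub_one_sub_id_le h
  linarith [(abs_le.1 this).2]

/-- The moment generating function of a centred Bernoulli variable. -/
lemma bernoulli_mgf_le {q a : ℝ} (h0 : 0 ≤ q) (ha : |a| ≤ 1) :
    q * Real.exp (a * (1 - q)) + (1 - q) * Real.exp (a * (0 - q)) ≤ Real.exp (a ^ 2 * q) := by
  have h1 : q * Real.exp (a * (1 - q)) + (1 - q) * Real.exp (a * (0 - q)) =
      (1 + q * (Real.exp a - 1)) * Real.exp (-(a * q)) := by
    have : Real.exp (a * (1 - q)) = Real.exp a * Real.exp (-(a * q)) := by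
      rw [← Real.exp_add]; congr 1; ring
    rw [this, show a * (0 - q) = -(a * q) by ring]
    ring
  rw [h1]
  -- Uses `exp a - 1 ≤ a + a ^ 2` and `1 + u ≤ exp u`; the linear term `q * a` is then cancelled by
  -- the centring factor.
  have h2 : 1 + q * (Real.exp a - 1) ≤ Real.exp (q * (a + a ^ 2)) := by
    have := Real.add_one_le_exp (q * (a + a ^ 2))
    have := mul_le_mul_of_nonneg_left (exp_le_one_add_add_sq ha) h0
    linarith
  calc _ ≤ Real.exp (q * (a + a ^ 2)) * Real.exp (-(a * q)) := by gcongr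
    _ = _ := by rw [← Real.exp_add]; congr 1; ring

lemma graph_mgf_le {N : ℕ} {p : Fin N → Fin N → ℝ} (hp : IsEdgeProb p)
    (a : Fin N × Fin N → ℝ) (ha : ∀ e ∈ pairs N, |a e| ≤ 1) :
    ∑ G, bernoulliWeight p G * Real.exp (∑ e ∈ pairs N, a e * noise p G e.1 e.2) ≤
      Real.exp (∑ e ∈ pairs N, a e ^ 2 * p e.1 e.2) := by
  classical
  have key := sum_graph_prod
    (fun e : Fin N × Fin N => p e.1 e.2 * Real.exp (a e * (1 - p e.1 e.2)))
    (fun e => (1 - p e.1 e.2) * Real.exp (a e * (0 - p e.1 e.2)))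
  have h : ∀ G : SimpleGraph (Fin N),
      bernoulliWeight p G * Real.exp (∑ e ∈ pairs N, a e * noise p G e.1 e.2) =
      ∏ e ∈ pairs N, (if G.Adj e.1 e.2 then p e.1 e.2 * Real.exp (a e * (1 - p e.1 e.2))
        else (1 - p e.1 e.2) * Real.exp (a e * (0 - p e.1 e.2))) := by
    intro G
    rw [Real.exp_sum, bernoulliWeight, ← Finset.prod_mul_distrib]
    refine Finset.prod_congr rfl fun e he => ?_
    have hne := (mem_pairs.1 he).ne
    simp only [noise, Matrix.of_apply, hne, if_false]
    split_ifs <;> rfl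
  simp_rw [h, key, Real.exp_sum]
  refine Finset.prod_le_prod (fun e he => ?_) fun e he => ?_
  · have hne := (mem_pairs.1 he).ne
    have := hp.nonneg _ _ hne
    have := hp.le_one _ _ hne
    have : 0 ≤ 1 - p e.1 e.2 := by linarith
    positivity
  · exact bernoulli_mgf_le (hp.nonneg _ _ (mem_pairs.1 he).ne) (ha e he)

/-- Chernoff's bound for linear statistics of the edges. -/
lemma graph_tail_le {N : ℕ} {p : Fin N → Fin N → ℝ} (hp : IsEdgeProb p)
    (a : Fin N × Fin N → ℝ) (ha : ∀ e ∈ pairs N, |a e| ≤ 1) {V : ℝ}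
    (hV : ∑ e ∈ pairs N, a e ^ 2 * p e.1 e.2 ≤ V) (t : ℝ) :
    graphProb p {G | t ≤ ∑ e ∈ pairs N, a e * noise p G e.1 e.2} ≤ Real.exp (V - t) := by
  have h1 : graphProb p {G | t ≤ ∑ e ∈ pairs N, a e * noise p G e.1 e.2} ≤
      ∑ G, bernoulliWeight p G * Real.exp (∑ e ∈ pairs N, a e * noise p G e.1 e.2) *
        Real.exp (-t) := by
    refine Finset.sum_le_sum fun G _ => ?_
    rw [mul_assoc, ← Real.exp_add]
    by_cases hG : t ≤ ∑ e ∈ pairs N, a e * noise p G e.1 e.2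
    · rw [Set.indicator_of_mem (by exact hG)]
      exact le_mul_of_one_le_right (bernoulliWeight_nonneg hp G)
        (Real.one_le_exp (by linarith))
    · rw [Set.indicator_of_notMem (by exact hG)]
      exact mul_nonneg (bernoulliWeight_nonneg hp G) (Real.exp_nonneg _)
  rw [← Finset.sum_mul] at h1
  refine h1.trans ?_
  rw [sub_eq_add_neg, Real.exp_add]
  gcongr
  exact (graph_mgf_le hp a ha).trans (Real.exp_le_exp.2 hV)

lemma noise_symm {N : ℕ} {p : Fin N → Fin N → ℝ} (hp : IsEdgeProb p)
    (G : SimpleGraph (Fin N)) (i j : Fin N) : noise p G i j = noise p G j i := by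
  by_cases h : i = j
  · rw [h]
  · simp only [noise, Matrix.of_apply, h, Ne.symm h, if_false, hp.symm i j]
    by_cases hA : G.Adj i j
    · rw [if_pos hA, if_pos hA.symm]
    · rw [if_neg hA, if_neg fun h' => hA h'.symm]

lemma noise_diag {N : ℕ} (p : Fin N → Fin N → ℝ) (G : SimpleGraph (Fin N)) (i : Fin N) :
    noise p G i i = 0 := by
  simp [noise]

lemma sum_sum_eq_sum_pairs {N : ℕ} (F : Fin N → Fin N → ℝ) (hF : ∀ i, F i i = 0) :
    ∑ i, ∑ j, F i j = ∑ e ∈ pairs N, (F e.1 e.2 + F e.2 e.1) := by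
  have h1 : ∑ i, ∑ j, F i j = ∑ e : Fin N × Fin N, F e.1 e.2 := by
    rw [← Finset.univ_product_univ, Finset.sum_product]
  have h2 : ∑ e ∈ Finset.univ.filter (fun e : Fin N × Fin N => ¬ e.1 < e.2), F e.1 e.2 =
      ∑ e ∈ pairs N, F e.2 e.1 := by
    have h3 : ∑ e ∈ Finset.univ.filter (fun e : Fin N × Fin N => e.2 < e.1), F e.1 e.2 =
        ∑ e ∈ Finset.univ.filter (fun e : Fin N × Fin N => ¬ e.1 < e.2), F e.1 e.2 := by
      refine Finset.sum_subset (fun e he => ?_) fun e he he' => ?_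
      · simp only [Finset.mem_filter, Finset.mem_univ, true_and] at he ⊢
        exact not_lt.2 he.le
      · simp only [Finset.mem_filter, Finset.mem_univ, true_and] at he he'
        rw [show e.1 = e.2 from le_antisymm (not_lt.1 he') (not_lt.1 he), hF]
    rw [← h3]
    refine Finset.sum_bij' (fun e _ => e.swap) (fun e _ => e.swap) ?_ ?_ ?_ ?_ ?_ <;>
      simp [pairs]
  rw [h1, ← Finset.sum_filter_add_sum_filter_not _ (fun e : Fin N × Fin N => e.1 < e.2), h2,
    Finset.sum_add_distrib]
  rfl

/-- Chernoff's bound for bilinear statistics of the noise. -/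
lemma noise_tail_le {N : ℕ} {p : Fin N → Fin N → ℝ} (hp : IsEdgeProb p)
    (c : Fin N → Fin N → ℝ) (hc : ∀ i j, |c i j| ≤ 1) {V : ℝ}
    (hV : ∑ i, ∑ j, (if i = j then 0 else |c i j| * p i j) ≤ V) {θ : ℝ} (hθ : 0 ≤ θ)
    (hθ' : θ ≤ 1 / 2) (t : ℝ) :
    graphProb p {G | t ≤ ∑ i, ∑ j, c i j * noise p G i j} ≤
      Real.exp (2 * θ ^ 2 * V - θ * t) := by
  have h1 : ∀ G, θ * ∑ i, ∑ j, c i j * noise p G i j =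
      ∑ e ∈ pairs N, θ * (c e.1 e.2 + c e.2 e.1) * noise p G e.1 e.2 := by
    intro G
    rw [sum_sum_eq_sum_pairs _ (fun i => by simp [noise_diag]), Finset.mul_sum]
    refine Finset.sum_congr rfl fun e _ => ?_
    rw [noise_symm hp G e.2 e.1]; ring
  have h2 : ∀ e : Fin N × Fin N, |c e.1 e.2 + c e.2 e.1| ≤ 2 := fun e =>
    (abs_add_le _ _).trans (by linarith [hc e.1 e.2, hc e.2 e.1])
  -- An unordered pair carries the coefficient `c i j + c j i`, of absolute value at most `2`. Its
  -- square is thus at most `2 (|c i j| + |c j i|)`, whence the factor `2`; and `θ ≤ 1 / 2` keeps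
  -- the scaled coefficient within the range of the exponential moment bound.
  have h3 : ∑ e ∈ pairs N, (θ * (c e.1 e.2 + c e.2 e.1)) ^ 2 * p e.1 e.2 ≤ 2 * θ ^ 2 * V := by
    rw [sum_sum_eq_sum_pairs _ (fun i => by simp)] at hV
    refine le_trans ?_ (mul_le_mul_of_nonneg_left hV (by positivity))
    rw [Finset.mul_sum]
    refine Finset.sum_le_sum fun e he => ?_
    have hne := (mem_pairs.1 he).ne
    have hp0 := hp.nonneg _ _ hne
    rw [if_neg hne, if_neg hne.symm, ← hp.symm e.1 e.2, ← add_mul, ← mul_assoc]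
    refine mul_le_mul_of_nonneg_right ?_ hp0
    calc (θ * (c e.1 e.2 + c e.2 e.1)) ^ 2
        = θ ^ 2 * (|c e.1 e.2 + c e.2 e.1| * |c e.1 e.2 + c e.2 e.1|) := by
          rw [← sq, sq_abs, mul_pow]
      _ ≤ θ ^ 2 * (2 * (|c e.1 e.2| + |c e.2 e.1|)) := by
          gcongr
          · exact h2 e
          · exact abs_add_le _ _
      _ = _ := by ring
  refine (graphProb_mono hp fun G hG => ?_).trans (graph_tail_le hp
    (fun e => θ * (c e.1 e.2 + c e.2 e.1)) (fun e _ => ?_) h3 (θ * t))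
  · have hG' : t ≤ ∑ i, ∑ j, c i j * noise p G i j := hG
    change θ * t ≤ ∑ e ∈ pairs N, θ * (c e.1 e.2 + c e.2 e.1) * noise p G e.1 e.2
    rw [← h1]
    gcongr
  · rw [abs_mul, abs_of_nonneg hθ]
    nlinarith [h2 e, abs_nonneg (c e.1 e.2 + c e.2 e.1)]

lemma noise_abs_tail_le {N : ℕ} {p : Fin N → Fin N → ℝ} (hp : IsEdgeProb p)
    (c : Fin N → Fin N → ℝ) (hc : ∀ i j, |c i j| ≤ 1) {V : ℝ}
    (hV : ∑ i, ∑ j, (if i = j then 0 else |c i j| * p i j) ≤ V) {θ : ℝ} (hθ : 0 ≤ θ)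
    (hθ' : θ ≤ 1 / 2) (t : ℝ) :
    graphProb p {G | t ≤ |∑ i, ∑ j, c i j * noise p G i j|} ≤
      2 * Real.exp (2 * θ ^ 2 * V - θ * t) := by
  have h1 := noise_tail_le hp c hc hV hθ hθ' t
  have h2 := noise_tail_le hp (fun i j => - c i j) (by simpa using hc) (by simpa using hV)
    hθ hθ' t
  refine (graphProb_mono hp ?_).trans ((graphProb_union_le hp _ _).trans
    ((add_le_add h1 h2).trans (two_mul _).ge))
  intro G hG
  have hG' : t ≤ |∑ i, ∑ j, c i j * noise p G i j| := hG
  rcases le_abs.1 hG' with h | h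
  · exact Or.inl h
  · refine Or.inr ?_
    change t ≤ ∑ i, ∑ j, - c i j * noise p G i j
    simpa only [neg_mul, Finset.sum_neg_distrib] using h

/-! ### Quadratic forms -/

/-- The quadratic form of a matrix. -/
def quad {N : ℕ} (M : Matrix (Fin N) (Fin N) ℝ) (x : Fin N → ℝ) : ℝ :=
  ∑ i, ∑ j, M i j * (x i * x j)

lemma quad_eq_dotProduct {N : ℕ} (M : Matrix (Fin N) (Fin N) ℝ) (x : Fin N → ℝ) :
    quad M x = x ⬝ᵥ M.mulVec x := by
  simp only [quad, dotProduct, Matrix.mulVec, Finset.mul_sum]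
  exact Finset.sum_congr rfl fun i _ => Finset.sum_congr rfl fun j _ => by ring

/-- The spectrum of `topEigenvalue M • 1 - M` is the reflection of that of `M`, hence nonnegative,
so this matrix is positive semidefinite. The spectrum of `M` is finite, so the supremum does bound
every eigenvalue. -/
lemma quad_le_topEigenvalue {N : ℕ} {M : Matrix (Fin N) (Fin N) ℝ} (hM : M.IsHermitian)
    (x : Fin N → ℝ) : quad M x ≤ topEigenvalue M * (x ⬝ᵥ x) := by
  have hev : ∀ i, hM.eigenvalues i ≤ topEigenvalue M := by
    intro i
    unfold topEigenvalue
    rw [hM.spectrum_real_eq_range_eigenvalues]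
    exact le_csSup (Set.finite_range _).bddAbove ⟨i, rfl⟩
  have hpsd : (topEigenvalue M • (1 : Matrix (Fin N) (Fin N) ℝ) - M).PosSemidef := by
    have hH : (topEigenvalue M • (1 : Matrix (Fin N) (Fin N) ℝ) - M).IsHermitian := by
      refine Matrix.IsHermitian.sub ?_ hM
      simp [Matrix.IsHermitian]
    rw [hH.posSemidef_iff_eigenvalues_nonneg]
    intro i
    have hi : hH.eigenvalues i ∈ spectrum ℝ (topEigenvalue M • (1 : Matrix (Fin N) (Fin N) ℝ) - M) := by
      rw [hH.spectrum_real_eq_range_eigenvalues]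
      exact ⟨i, rfl⟩
    generalize hH.eigenvalues i = r at hi ⊢
    rw [← Algebra.algebraMap_eq_smul_one, ← spectrum.singleton_sub_eq,
      hM.spectrum_real_eq_range_eigenvalues] at hi
    obtain ⟨_, rfl, _, ⟨j, rfl⟩, rfl⟩ := Set.mem_sub.1 hi
    exact sub_nonneg.2 (hev j)
  have := hpsd.dotProduct_mulVec_nonneg x
  rw [quad_eq_dotProduct]
  simp only [star_trivial, Matrix.sub_mulVec, Matrix.smul_mulVec, Matrix.one_mulVec,
    dotProduct_sub, dotProduct_smul, smul_eq_mul] at this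
  linarith

lemma quad_of_isTopUnitEigenvector {N : ℕ} {M : Matrix (Fin N) (Fin N) ℝ} {x : Fin N → ℝ}
    (h : IsTopUnitEigenvector M x) : quad M x = topEigenvalue M := by
  rw [quad_eq_dotProduct, h.2, dotProduct_smul, h.1, smul_eq_mul, mul_one]

/-- The quadratic form of a matrix with nonnegative entries is bounded in absolute value by its
largest eigenvalue. -/
lemma abs_quad_le_topEigenvalue {N : ℕ} {M : Matrix (Fin N) (Fin N) ℝ} (hM : M.IsHermitian)
    (h0 : ∀ i j, 0 ≤ M i j) (x : Fin N → ℝ) : |quad M x| ≤ topEigenvalue M * (x ⬝ᵥ x) := by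
  -- Replacing coordinates by their absolute values keeps the norm and, the entries being
  -- nonnegative, dominates the form with either sign.
  have h1 := quad_le_topEigenvalue hM fun i => |x i|
  have h2 : (fun i => |x i|) ⬝ᵥ (fun i => |x i|) = x ⬝ᵥ x := by simp [dotProduct]
  rw [h2] at h1
  refine le_trans ?_ h1
  unfold quad
  refine (Finset.abs_sum_le_sum_abs _ _).trans (Finset.sum_le_sum fun i _ => ?_)
  refine (Finset.abs_sum_le_sum_abs _ _).trans (Finset.sum_le_sum fun j _ => ?_)
  rw [abs_mul, abs_mul, abs_of_nonneg (h0 i j)]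

/-- Schur's test. -/
lemma abs_quad_le_of_row_sum_le {N : ℕ} {M : Matrix (Fin N) (Fin N) ℝ}
    (hsymm : ∀ i j, M i j = M j i) {R : ℝ} (hR : ∀ i, ∑ j, |M i j| ≤ R) (x : Fin N → ℝ) :
    |quad M x| ≤ R * (x ⬝ᵥ x) := by
  have h1 : |quad M x| ≤ ∑ i, ∑ j, (|M i j| * (x i ^ 2) / 2 + |M j i| * x j ^ 2 / 2) := by
    refine (Finset.abs_sum_le_sum_abs _ _).trans (Finset.sum_le_sum fun i _ => ?_)
    refine (Finset.abs_sum_le_sum_abs _ _).trans (Finset.sum_le_sum fun j _ => ?_)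
    rw [abs_mul, abs_mul, ← hsymm i j, ← sq_abs (x i), ← sq_abs (x j)]
    nlinarith [mul_nonneg (abs_nonneg (M i j)) (sq_nonneg (|x i| - |x j|))]
  have h2 : ∑ i, ∑ j, |M i j| * (x i ^ 2) / 2 ≤ R * (x ⬝ᵥ x) / 2 := by
    rw [dotProduct, Finset.mul_sum, Finset.sum_div]
    refine Finset.sum_le_sum fun i _ => ?_
    rw [← Finset.sum_div, ← Finset.sum_mul, ← sq]
    have := mul_le_mul_of_nonneg_right (hR i) (sq_nonneg (x i))
    linarith
  have h3 : ∑ i, ∑ j, |M j i| * (x j ^ 2) / 2 = ∑ i, ∑ j, |M i j| * (x i ^ 2) / 2 :=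
    Finset.sum_comm
  simp only [Finset.sum_add_distrib] at h1
  linarith

/-! ### A spectral bound from discrepancy -/

/-- A linear form on the cube is controlled by its values on the indicators of sets. -/
lemma abs_sum_mul_le_of_forall_subset {ι : Type*} [DecidableEq ι] (S : Finset ι) (a c : ι → ℝ)
    (ha : ∀ i ∈ S, |a i| ≤ 1) {B : ℝ} (hB : ∀ T ⊆ S, |∑ i ∈ T, c i| ≤ B) :
    |∑ i ∈ S, a i * c i| ≤ 2 * B := by
  have h1 : |∑ i ∈ S, a i * c i| ≤ ∑ i ∈ S, |c i| := by
    refine (Finset.abs_sum_le_sum_abs _ _).trans (Finset.sum_le_sum fun i hi => ?_)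
    rw [abs_mul]
    exact mul_le_of_le_one_left (abs_nonneg _) (ha i hi)
  rw [← Finset.sum_filter_add_sum_filter_not S (fun i => 0 ≤ c i) fun i => |c i|] at h1
  have h2 : ∑ i ∈ S with 0 ≤ c i, |c i| ≤ B := by
    rw [Finset.sum_congr rfl fun i hi => abs_of_nonneg (Finset.mem_filter.1 hi).2]
    exact (le_abs_self _).trans (hB _ (Finset.filter_subset _ _))
  have h3 : ∑ i ∈ S with ¬ 0 ≤ c i, |c i| ≤ B := by
    rw [Finset.sum_congr rfl fun i hi => abs_of_neg (not_le.1 (Finset.mem_filter.1 hi).2),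
      Finset.sum_neg_distrib]
    exact (neg_le_abs _).trans (hB _ (Finset.filter_subset _ _))
  linarith

lemma abs_bilin_le_of_forall_subset {N : ℕ} (W : Matrix (Fin N) (Fin N) ℝ)
    (S T : Finset (Fin N)) (a b : Fin N → ℝ) (ha : ∀ i ∈ S, |a i| ≤ 1) (hb : ∀ i ∈ T, |b i| ≤ 1)
    {B : ℝ} (hB : ∀ S' ⊆ S, ∀ T' ⊆ T, |∑ i ∈ S', ∑ j ∈ T', W i j| ≤ B) :
    |∑ i ∈ S, ∑ j ∈ T, W i j * (a i * b j)| ≤ 4 * B := by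
  have h1 : ∑ i ∈ S, ∑ j ∈ T, W i j * (a i * b j) =
      ∑ i ∈ S, a i * ∑ j ∈ T, b j * W i j := by
    simp_rw [Finset.mul_sum]
    exact Finset.sum_congr rfl fun i _ => Finset.sum_congr rfl fun j _ => by ring
  rw [h1, show 4 * B = 2 * (2 * B) by ring]
  refine abs_sum_mul_le_of_forall_subset S a _ ha fun S' hS' => ?_
  rw [Finset.sum_comm]
  simp_rw [← Finset.mul_sum]
  refine abs_sum_mul_le_of_forall_subset T b _ hb fun T' hT' => ?_
  rw [Finset.sum_comm]
  exact hB S' hS' T' hT'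

/-- A symmetric matrix with small discrepancy and bounded row sums has a small quadratic form
(a variant of the lemma of Bilu and Linial). -/
lemma abs_quad_le_of_discrepancy {N : ℕ} {W : Matrix (Fin N) (Fin N) ℝ}
    (hsymm : ∀ i j, W i j = W j i) {α R : ℝ} (hα : 0 ≤ α)
    (hdisc : ∀ S T : Finset (Fin N), |∑ i ∈ S, ∑ j ∈ T, W i j| ≤ α * (√S.card * √T.card))
    (hR : ∀ i, ∑ j, |W i j| ≤ R) (k : ℕ) (x : Fin N → ℝ) :
    |quad W x| ≤ (4 * R / 2 ^ k + 16 * (2 * k + 1) * α) * (x ⬝ᵥ x) := by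
  -- Coordinates are grouped by dyadic size. When two levels differ by more than `k`, one coordinate
  -- is at most `2 / 2 ^ k` times the other, and row sums suffice; pairs of nearby levels are
  -- treated by discrepancy. A zero coordinate gets the default level `0`, so `s` excludes it from
  -- the level sets.
  set l : Fin N → ℤ := fun i => Int.log 2 |x i| with hl
  set L : Finset ℤ := Finset.univ.image l with hL
  set s : Finset (Fin N) := Finset.univ.filter fun i => x i ≠ 0 with hs
  set S : ℤ → Finset (Fin N) := fun m => s.filter fun i => l i = m with hS
  have hlow : ∀ i, x i ≠ 0 → (2 : ℝ) ^ l i ≤ |x i| := fun i hi => by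
    exact_mod_cast Int.zpow_log_le_self (b := 2) one_lt_two (abs_pos.2 hi)
  have hup : ∀ i, |x i| ≤ (2 : ℝ) ^ (l i + 1) := fun i => by
    exact_mod_cast (Int.lt_zpow_succ_log_self (b := 2) one_lt_two |x i|).le
  set near : Fin N → Fin N → Prop := fun i j => |l i - l j| ≤ k with hnear
  -- far pairs
  have hfar_entry : ∀ i j, ¬ near i j → |x i| * |x j| ≤ (x i ^ 2 + x j ^ 2) * (2 / 2 ^ k) := by
    have aux : ∀ i j, l i + (k + 1) ≤ l j → x j ≠ 0 → |x i| * |x j| ≤ x j ^ 2 * (2 / 2 ^ k) := by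
      intro i j hij hj
      have h1 : |x i| ≤ |x j| * (2 / 2 ^ k) := by
        calc |x i| ≤ (2 : ℝ) ^ (l i + 1) := hup i
          _ ≤ (2 : ℝ) ^ (l j - k + 1) := zpow_le_zpow_right₀ one_le_two (by omega)
          _ = (2 : ℝ) ^ (l j) * (2 / 2 ^ k) := by
            rw [zpow_add₀ two_ne_zero, zpow_sub₀ two_ne_zero, zpow_natCast, zpow_one]; ring
          _ ≤ _ := by gcongr; exact hlow j hj
      calc |x i| * |x j| ≤ |x j| * (2 / 2 ^ k) * |x j| := by gcongr
        _ = |x j| ^ 2 * (2 / 2 ^ k) := by ring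
        _ = _ := by rw [sq_abs]
    intro i j hij
    have hc : (0 : ℝ) ≤ 2 / 2 ^ k := by positivity
    by_cases hi : x i = 0
    · rw [hi]; simp only [abs_zero, zero_mul]; positivity
    by_cases hj : x j = 0
    · rw [hj]; simp only [abs_zero, mul_zero]; positivity
    rw [hnear, not_le, lt_abs] at hij
    rcases hij with h | h
    · have := aux j i (by omega) hi
      nlinarith [mul_nonneg (sq_nonneg (x j)) hc]
    · have := aux i j (by omega) hj
      nlinarith [mul_nonneg (sq_nonneg (x i)) hc]
  classical
  have hrow : ∑ i, ∑ j, |W i j| * x i ^ 2 ≤ R * (x ⬝ᵥ x) := by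
    rw [dotProduct, Finset.mul_sum]
    refine Finset.sum_le_sum fun i _ => ?_
    rw [← Finset.sum_mul, ← sq]
    exact mul_le_mul_of_nonneg_right (hR i) (sq_nonneg (x i))
  have hfar : |∑ i, ∑ j, (if near i j then 0 else W i j * (x i * x j))| ≤
      4 * R / 2 ^ k * (x ⬝ᵥ x) := by
    have h1 : |∑ i, ∑ j, (if near i j then 0 else W i j * (x i * x j))| ≤
        ∑ i, ∑ j, (|W i j| * x i ^ 2 + |W j i| * x j ^ 2) * (2 / 2 ^ k) := by
      refine (Finset.abs_sum_le_sum_abs _ _).trans (Finset.sum_le_sum fun i _ => ?_)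
      refine (Finset.abs_sum_le_sum_abs _ _).trans (Finset.sum_le_sum fun j _ => ?_)
      rw [← hsymm i j, ← mul_add]
      split_ifs with h
      · rw [abs_zero]; positivity
      · rw [abs_mul, abs_mul, mul_assoc]
        exact mul_le_mul_of_nonneg_left (hfar_entry i j h) (abs_nonneg _)
    have h3 : ∑ i, ∑ j, |W j i| * (x j ^ 2) = ∑ i, ∑ j, |W i j| * (x i ^ 2) := Finset.sum_comm
    simp_rw [← Finset.sum_mul, Finset.sum_add_distrib] at h1
    rw [h3] at h1
    refine h1.trans ?_
    have hc : (0 : ℝ) ≤ 2 / 2 ^ k := by positivity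
    calc _ ≤ (R * (x ⬝ᵥ x) + R * (x ⬝ᵥ x)) * (2 / 2 ^ k) := by gcongr
      _ = _ := by ring
  -- near pairs
  have hfib : ∀ f : Fin N → ℝ, (∀ i, x i = 0 → f i = 0) → ∑ i, f i = ∑ m ∈ L, ∑ i ∈ S m, f i := by
    intro f hf
    rw [hS, Finset.sum_fiberwise_of_maps_to (fun i _ => Finset.mem_image_of_mem l (Finset.mem_univ i))]
    refine (Finset.sum_subset (Finset.subset_univ _) fun i _ hi => hf i ?_).symm
    simpa [hs] using hi
  -- `u m` is, up to a factor `2`, the Euclidean norm of the part of `x` on level `m`.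
  set u : ℤ → ℝ := fun m => 2 ^ m * √(S m).card with hu
  have hu_sum : ∑ m ∈ L, u m ^ 2 ≤ x ⬝ᵥ x := by
    rw [dotProduct, hfib _ fun i hi => by rw [hi, zero_mul]]
    refine Finset.sum_le_sum fun m _ => ?_
    rw [hu, mul_pow, Real.sq_sqrt (Nat.cast_nonneg _), mul_comm, ← nsmul_eq_mul]
    refine Finset.card_nsmul_le_sum _ _ _ fun i hi => ?_
    obtain ⟨h1, rfl⟩ := Finset.mem_filter.1 hi
    rw [← sq, ← sq_abs (x i)]
    have := hlow i (Finset.mem_filter.1 h1).2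
    gcongr
  -- Dividing by `2 ^ (m + 1)` and `2 ^ (n + 1)` puts the coordinates in the unit cube. The constant
  -- `16` is `4` from passing to subsets times `2 * 2` from these shifts.
  have hblock : ∀ m n, |∑ i ∈ S m, ∑ j ∈ S n, W i j * (x i * x j)| ≤ 16 * α * (u m * u n) := by
    intro m n
    have h1 : ∑ i ∈ S m, ∑ j ∈ S n, W i j * (x i * x j) =
        2 ^ (m + 1) * 2 ^ (n + 1) *
          ∑ i ∈ S m, ∑ j ∈ S n, W i j * (x i / 2 ^ (m + 1) * (x j / 2 ^ (n + 1))) := by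
      simp_rw [Finset.mul_sum]
      refine Finset.sum_congr rfl fun i _ => Finset.sum_congr rfl fun j _ => ?_
      have h2 : (2 : ℝ) ^ (m + 1) ≠ 0 := by positivity
      have h3 : (2 : ℝ) ^ (n + 1) ≠ 0 := by positivity
      field_simp
    have h2 : ∀ m, ∀ i ∈ S m, |x i / (2 : ℝ) ^ (m + 1)| ≤ 1 := by
      intro m i hi
      obtain ⟨_, rfl⟩ := Finset.mem_filter.1 hi
      rw [abs_div, abs_of_pos (by positivity : (0 : ℝ) < 2 ^ (l i + 1)),
        div_le_one (by positivity)]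
      exact hup i
    have h3 := abs_bilin_le_of_forall_subset W (S m) (S n) (fun i => x i / (2 : ℝ) ^ (m + 1))
      (fun i => x i / (2 : ℝ) ^ (n + 1)) (h2 m) (h2 n)
      (B := α * (√(S m).card * √(S n).card)) fun S' hS' T' hT' => by
        refine (hdisc S' T').trans ?_
        have := Finset.card_le_card hS'
        have := Finset.card_le_card hT'
        gcongr
    rw [h1, abs_mul, abs_of_pos (by positivity)]
    calc _ ≤ (2 : ℝ) ^ (m + 1) * 2 ^ (n + 1) * (4 * (α * (√(S m).card * √(S n).card))) := by
          gcongr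
      _ = _ := by
          rw [zpow_add₀ two_ne_zero, zpow_add₀ two_ne_zero, zpow_one, hu]; ring
  have hnear_eq : ∑ i, ∑ j, (if near i j then W i j * (x i * x j) else 0) =
      ∑ m ∈ L, ∑ n ∈ L with |m - n| ≤ k, ∑ i ∈ S m, ∑ j ∈ S n, W i j * (x i * x j) := by
    rw [hfib _ fun i hi => Finset.sum_eq_zero fun j _ => by simp [hi]]
    refine Finset.sum_congr rfl fun m _ => ?_
    have h1 : ∀ i ∈ S m, ∑ j, (if near i j then W i j * (x i * x j) else 0) =
        ∑ n ∈ L, if |m - n| ≤ k then ∑ j ∈ S n, W i j * (x i * x j) else 0 := by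
      intro i hi
      obtain ⟨_, rfl⟩ := Finset.mem_filter.1 hi
      rw [hfib _ fun j hj => by simp [hj]]
      refine Finset.sum_congr rfl fun n _ => ?_
      split_ifs with hn
      · refine Finset.sum_congr rfl fun j hj => if_pos ?_
        obtain ⟨_, rfl⟩ := Finset.mem_filter.1 hj
        exact hn
      · refine Finset.sum_eq_zero fun j hj => if_neg ?_
        obtain ⟨_, rfl⟩ := Finset.mem_filter.1 hj
        exact hn
    rw [Finset.sum_congr rfl h1, Finset.sum_comm]
    refine Eq.trans ?_ (Finset.sum_filter _ _).symm
    refine Finset.sum_congr rfl fun n _ => ?_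
    split_ifs
    · rfl
    · simp
  have hcard : ∀ m : ℤ, ((L.filter fun n => |m - n| ≤ k).card : ℝ) ≤ 2 * k + 1 := by
    intro m
    have h1 : (L.filter fun n => |m - n| ≤ k) ⊆ Finset.Icc (m - k) (m + k) := by
      intro n hn
      have := abs_le.1 (Finset.mem_filter.1 hn).2
      rw [Finset.mem_Icc]
      omega
    have h2 := Finset.card_le_card h1
    rw [Int.card_Icc] at h2
    have h3 : (L.filter fun n => |m - n| ≤ k).card ≤ 2 * k + 1 := by omega
    exact_mod_cast h3
  have hnear_le : |∑ i, ∑ j, (if near i j then W i j * (x i * x j) else 0)| ≤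
      16 * (2 * k + 1) * α * (x ⬝ᵥ x) := by
    have h1 : ∑ m ∈ L, ∑ n ∈ L with |m - n| ≤ k, u m ^ 2 ≤ (2 * k + 1) * (x ⬝ᵥ x) := by
      simp_rw [Finset.sum_const, nsmul_eq_mul]
      calc _ ≤ ∑ m ∈ L, (2 * k + 1) * u m ^ 2 :=
            Finset.sum_le_sum fun m _ => mul_le_mul_of_nonneg_right (hcard m) (sq_nonneg _)
        _ ≤ _ := by rw [← Finset.mul_sum]; gcongr
    have h2 : ∑ m ∈ L, ∑ n ∈ L with |m - n| ≤ k, u n ^ 2 =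
        ∑ m ∈ L, ∑ n ∈ L with |m - n| ≤ k, u m ^ 2 := by
      simp_rw [Finset.sum_filter]
      rw [Finset.sum_comm]
      simp_rw [abs_sub_comm]
    rw [hnear_eq]
    -- `2 u m u n ≤ u m ^ 2 + u n ^ 2`; each level then occurs at most `2 k + 1` times on either
    -- side.
    calc _ ≤ ∑ m ∈ L, ∑ n ∈ L with |m - n| ≤ k, 8 * α * (u m ^ 2 + u n ^ 2) := by
          refine (Finset.abs_sum_le_sum_abs _ _).trans (Finset.sum_le_sum fun m _ => ?_)
          refine (Finset.abs_sum_le_sum_abs _ _).trans (Finset.sum_le_sum fun n _ => ?_)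
          refine (hblock m n).trans ?_
          nlinarith [mul_nonneg hα (sq_nonneg (u m - u n))]
      _ = 16 * α * ∑ m ∈ L, ∑ n ∈ L with |m - n| ≤ k, u m ^ 2 := by
          simp_rw [← Finset.mul_sum, Finset.sum_add_distrib]
          rw [h2]; ring
      _ ≤ 16 * α * ((2 * k + 1) * (x ⬝ᵥ x)) := by gcongr
      _ = _ := by ring
  have hsplit : quad W x = ∑ i, ∑ j, (if near i j then 0 else W i j * (x i * x j)) +
      ∑ i, ∑ j, (if near i j then W i j * (x i * x j) else 0) := by
    rw [quad, ← Finset.sum_add_distrib]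
    refine Finset.sum_congr rfl fun i _ => ?_
    rw [← Finset.sum_add_distrib]
    refine Finset.sum_congr rfl fun j _ => ?_
    split_ifs <;> simp
  rw [hsplit, add_mul]
  exact (abs_add_le _ _).trans (add_le_add hfar hnear_le)

/-! ### Concentration of the noise -/

/-- The expected degrees are at most `D`. -/
def DegreesLE {N : ℕ} (p : Fin N → Fin N → ℝ) (D : ℝ) : Prop :=
  ∀ i, ∑ j, (if i = j then 0 else p i j) ≤ D

/-- The vector with entries `± 1` given by `s`. -/
def pm {N : ℕ} (s : Fin N → Bool) : Fin N → ℝ := fun i => if s i then 1 else -1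

lemma abs_pm {N : ℕ} (s : Fin N → Bool) (i : Fin N) : |pm s i| = 1 := by
  unfold pm; split_ifs <;> simp

/-- Chernoff for each fixed sign vector, with the optimal `θ = τ / (4 D)`, beats the `2 ^ N ≤ exp N`
terms of the union bound once `τ ^ 2` exceeds `8 D`. The condition `τ ≤ 2 D` is `θ ≤ 1 / 2`. -/
lemma noise_quad_sign_le {N : ℕ} {p : Fin N → Fin N → ℝ} (hp : IsEdgeProb p) {D τ : ℝ}
    (hD : DegreesLE p D) (hD0 : 0 < D) (hτ : 0 ≤ τ) (hτD : τ ≤ 2 * D) :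
    graphProb p {G | ∃ s : Fin N → Bool, N * τ ≤ |quad (noise p G) (pm s)|} ≤
      2 * Real.exp (N * (1 - τ ^ 2 / (8 * D))) := by
  have h1 : ∀ s : Fin N → Bool, graphProb p {G | N * τ ≤ |quad (noise p G) (pm s)|} ≤
      2 * Real.exp (- (N * (τ ^ 2 / (8 * D)))) := by
    intro s
    have hV : ∑ i, ∑ j, (if i = j then 0 else |pm s i * pm s j| * p i j) ≤ N * D := by
      simp only [abs_mul, abs_pm, one_mul]
      refine (Finset.sum_le_card_nsmul _ _ _ fun i _ => hD i).trans ?_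
      simp
    have h := noise_abs_tail_le hp (fun i j => pm s i * pm s j)
      (fun i j => by rw [abs_mul, abs_pm, abs_pm, one_mul]) hV (θ := τ / (4 * D))
      (by positivity) (by rw [div_le_iff₀ (by positivity)]; linarith) (N * τ)
    have h2 : 2 * (τ / (4 * D)) ^ 2 * (N * D) - τ / (4 * D) * (N * τ) =
        - (N * (τ ^ 2 / (8 * D))) := by
      field_simp; ring
    rw [h2] at h
    simpa only [quad, mul_comm (noise _ _ _ _)] using h
  have h3 := graphProb_biUnion_le hp Finset.univ
    (fun s : Fin N → Bool => {G | N * τ ≤ |quad (noise p G) (pm s)|})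
  have h4 : ((2 : ℝ) ^ N) ≤ Real.exp N := by
    rw [← Real.exp_one_pow]
    gcongr
    have := Real.add_one_le_exp 1
    linarith
  calc _ ≤ ∑ s : Fin N → Bool, graphProb p {G | N * τ ≤ |quad (noise p G) (pm s)|} := by
        simpa using h3
    _ ≤ ∑ s : Fin N → Bool, 2 * Real.exp (- (N * (τ ^ 2 / (8 * D)))) :=
        Finset.sum_le_sum fun s _ => h1 s
    _ = 2 * (2 ^ N * Real.exp (- (N * (τ ^ 2 / (8 * D))))) := by simp; ring
    _ ≤ 2 * (Real.exp N * Real.exp (- (N * (τ ^ 2 / (8 * D))))) := by gcongr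
    _ = _ := by rw [← Real.exp_add]; ring_nf

/-- Entrywise `|A - p| ≤ (A - p) + 2 p`, so an absolute row sum exceeds the signed one by at most `2
D`, and Chernoff for the signed sum at level `2 D` is enough. -/
lemma noise_row_sum_le {N : ℕ} {p : Fin N → Fin N → ℝ} (hp : IsEdgeProb p) {D : ℝ}
    (hD : DegreesLE p D) :
    graphProb p {G | ∃ i, 4 * D ≤ ∑ j, |noise p G i j|} ≤ N * Real.exp (- (D / 2)) := by
  classical
  have h1 : ∀ i, graphProb p {G | 2 * D ≤ ∑ j, noise p G i j} ≤ Real.exp (- (D / 2)) := by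
    intro i
    have h := noise_tail_le hp (fun i' _ => if i' = i then 1 else 0)
      (fun i' j => by split_ifs <;> simp) (V := D) ?_ (θ := 1 / 2) (by norm_num) le_rfl (2 * D)
    · have h' : ∀ G, ∑ i', ∑ j, (if i' = i then 1 else 0) * noise p G i' j =
          ∑ j, noise p G i j := by
        intro G
        rw [Finset.sum_eq_single i (fun b _ hb => by simp [hb]) (by simp)]
        simp
      simp_rw [h'] at h
      refine h.trans (le_of_eq ?_)
      congr 1; ring
    · refine le_trans (le_of_eq ?_) (hD i)
      rw [Finset.sum_eq_single i]
      · simp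
      · intro b _ hb; simp [hb]
      · simp
  have h2 := graphProb_biUnion_le hp Finset.univ (fun i => {G | 2 * D ≤ ∑ j, noise p G i j})
  calc _ ≤ graphProb p {G | ∃ i ∈ Finset.univ, G ∈ {G | 2 * D ≤ ∑ j, noise p G i j}} := by
        refine graphProb_mono hp ?_
        rintro G ⟨i, hi⟩
        refine ⟨i, Finset.mem_univ _, ?_⟩
        have h3 : ∑ j, |noise p G i j| ≤
            ∑ j, (noise p G i j + 2 * (if i = j then 0 else p i j)) := by
          refine Finset.sum_le_sum fun j _ => ?_
          by_cases hij : i = j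
          · simp [hij, noise_diag]
          · have := hp.nonneg i j hij
            have := hp.le_one i j hij
            simp only [noise, Matrix.of_apply, hij, if_false]
            split_ifs
            · rw [abs_of_nonneg (by linarith)]; linarith
            · rw [abs_of_nonpos (by linarith)]; linarith
        rw [Finset.sum_add_distrib, ← Finset.mul_sum] at h3
        have := hD i
        change 2 * D ≤ _
        linarith
    _ ≤ _ := h2
    _ ≤ ∑ i : Fin N, Real.exp (- (D / 2)) := Finset.sum_le_sum fun i _ => h1 i
    _ = _ := by simp

lemma sum_pow_card_eq {N : ℕ} (q : ℝ) : ∑ S : Finset (Fin N), q ^ S.card = (q + 1) ^ N := by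
  have := Finset.prod_add_one (f := fun _ : Fin N => q) Finset.univ
  simpa using this.symm

lemma sum_sum_eq_indicator {N : ℕ} (W : Matrix (Fin N) (Fin N) ℝ) (S T : Finset (Fin N)) :
    ∑ i ∈ S, ∑ j ∈ T, W i j =
      ∑ i, ∑ j, (if i ∈ S ∧ j ∈ T then 1 else 0) * W i j := by
  rw [← Finset.sum_subset (Finset.subset_univ S) fun i _ hi => by simp [hi]]
  refine Finset.sum_congr rfl fun i hi => ?_
  rw [← Finset.sum_subset (Finset.subset_univ T) fun j _ hj => by simp [hj]]
  exact Finset.sum_congr rfl fun j hj => by simp [hi, hj]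

lemma sum_sum_eq_sum_sum_of_symm {N : ℕ} {W : Matrix (Fin N) (Fin N) ℝ}
    (hsymm : ∀ i j, W i j = W j i) (S T : Finset (Fin N)) :
    ∑ i ∈ S, ∑ j ∈ T, W i j = ∑ i ∈ T, ∑ j ∈ S, W i j :=
  Finset.sum_comm.trans
    (Finset.sum_congr rfl fun _ _ => Finset.sum_congr rfl fun _ _ => hsymm _ _)

/-- The pairs of sets on which the discrepancy is not bounded trivially. -/
def criticalPairs (N : ℕ) (D α : ℝ) : Finset (Finset (Fin N) × Finset (Fin N)) := by
  classical
  exact Finset.univ.filter fun P =>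
    P.2.card ≤ P.1.card ∧ 1 ≤ P.2.card ∧ α * √P.1.card ≤ 4 * D * √P.2.card

/-- Chernoff with `θ = α √(|S| / |T|) / (8 D)` and variance proxy `|T| D`, counted from the smaller
set. The last condition in `criticalPairs` says exactly that `θ ≤ 1 / 2`. -/
lemma noise_discrepancy_tail_le {N : ℕ} {p : Fin N → Fin N → ℝ} (hp : IsEdgeProb p) {D α : ℝ}
    (hD : DegreesLE p D) (hD0 : 0 < D) (hα : 0 ≤ α) {S T : Finset (Fin N)}
    (h : (S, T) ∈ criticalPairs N D α) :
    graphProb p {G | α * (√S.card * √T.card) ≤ |∑ i ∈ S, ∑ j ∈ T, noise p G i j|} ≤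
      2 * Real.exp (- (3 * α ^ 2 / (32 * D) * S.card)) := by
  classical
  simp only [criticalPairs, Finset.mem_filter, Finset.mem_univ, true_and] at h
  obtain ⟨hle, hT, hcrit⟩ := h
  have hT0 : (0 : ℝ) < √T.card := Real.sqrt_pos.2 (by exact_mod_cast hT)
  have hV : ∑ i, ∑ j, (if i = j then 0 else |if i ∈ S ∧ j ∈ T then (1 : ℝ) else 0| * p i j) ≤
      T.card * D := by
    rw [Finset.sum_comm]
    have h1 : ∀ j, ∑ i, (if i = j then 0 else |if i ∈ S ∧ j ∈ T then (1 : ℝ) else 0| * p i j) ≤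
        if j ∈ T then D else 0 := by
      intro j
      split_ifs with hj
      · refine le_trans (Finset.sum_le_sum fun i _ => ?_) (hD j)
        by_cases hij : i = j
        · simp [hij]
        · rw [if_neg hij, if_neg (Ne.symm hij), hp.symm j i]
          have := hp.nonneg i j hij
          split_ifs <;> simp [this]
      · exact (Finset.sum_eq_zero fun i _ => by simp [hj]).le
    refine (Finset.sum_le_sum fun j _ => h1 j).trans ?_
    simp
  have hθ' : α * (√S.card / √T.card) / (8 * D) ≤ 1 / 2 := by
    rw [div_le_iff₀ (by positivity), ← mul_div_assoc, div_le_iff₀ hT0]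
    linarith
  have h := noise_abs_tail_le hp (fun i j => if i ∈ S ∧ j ∈ T then (1 : ℝ) else 0)
    (fun i j => by split_ifs <;> simp) hV (by positivity) hθ' (α * (√S.card * √T.card))
  simp_rw [← sum_sum_eq_indicator] at h
  refine h.trans (le_of_eq ?_)
  congr 2
  have hs := Real.sq_sqrt (Nat.cast_nonneg (α := ℝ) S.card)
  have ht := Real.sq_sqrt (Nat.cast_nonneg (α := ℝ) T.card)
  generalize √(S.card : ℝ) = a at hs
  generalize √(T.card : ℝ) = b at ht hT0
  rw [← hs, ← ht]
  field_simp
  ring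

/-- The hypothesis on `α` turns each tail into at most `2 N ^ (-6 |S|)`. As `1 + |S| + |T| ≤ 3 |S|`,
this is at most `2 q * q ^ |S| * q ^ |T|` with `q = N ^ (-2)`, and summing over all pairs of sets
costs only `(1 + q) ^ (2 N) ≤ exp 2`. -/
lemma noise_discrepancy_le {N : ℕ} {p : Fin N → Fin N → ℝ} (hp : IsEdgeProb p) {D α : ℝ}
    (hD : DegreesLE p D) (hD0 : 0 < D) (hα : 0 ≤ α) (hN : 1 ≤ N)
    (hαD : 64 * D * Real.log N ≤ α ^ 2) :
    graphProb p {G | ∃ P ∈ criticalPairs N D α, α * (√P.1.card * √P.2.card) ≤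
      |∑ i ∈ P.1, ∑ j ∈ P.2, noise p G i j|} ≤ 2 * Real.exp 2 / N := by
  have hN0 : (0 : ℝ) < N := by exact_mod_cast hN
  set q : ℝ := Real.exp (- (2 * Real.log N)) with hq
  have hqN : q = 1 / N ^ 2 := by
    rw [hq, Real.exp_neg, mul_comm, Real.exp_mul, Real.exp_log hN0]; simp
  have hterm : ∀ P ∈ criticalPairs N D α,
      graphProb p {G | α * (√P.1.card * √P.2.card) ≤ |∑ i ∈ P.1, ∑ j ∈ P.2, noise p G i j|} ≤
        2 * q * (q ^ P.1.card * q ^ P.2.card) := by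
    intro P hP
    refine (noise_discrepancy_tail_le hp hD hD0 hα hP).trans ?_
    simp only [criticalPairs, Finset.mem_filter, Finset.mem_univ, true_and] at hP
    have h1 : (1 : ℝ) ≤ P.2.card := by exact_mod_cast hP.2.1
    have h2 : (P.2.card : ℝ) ≤ P.1.card := by exact_mod_cast hP.1
    rw [mul_assoc, hq, ← Real.exp_nat_mul, ← Real.exp_nat_mul, ← Real.exp_add, ← Real.exp_add]
    gcongr
    have h3 : 6 * Real.log N ≤ 3 * α ^ 2 / (32 * D) := by
      rw [le_div_iff₀ (by positivity)]; linarith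
    have h4 := mul_le_mul_of_nonneg_right h3 (by linarith : (0 : ℝ) ≤ P.1.card)
    have h5 : 0 ≤ Real.log N := Real.log_nonneg (by exact_mod_cast hN)
    nlinarith
  refine (graphProb_biUnion_le hp _ _).trans ((Finset.sum_le_sum hterm).trans ?_)
  have hq0 : 0 ≤ q := (Real.exp_pos _).le
  have h1 : (q + 1) ^ N ≤ Real.exp 1 := by
    have h2 : (q + 1) ^ N ≤ Real.exp (N * q) := by
      rw [Real.exp_nat_mul]
      gcongr
      exact Real.add_one_le_exp q
    refine h2.trans (Real.exp_le_exp.2 ?_)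
    rw [hqN, mul_one_div, div_le_one (by positivity)]
    nlinarith [(by exact_mod_cast hN : (1 : ℝ) ≤ N)]
  calc _ ≤ ∑ P : Finset (Fin N) × Finset (Fin N), 2 * q * (q ^ P.1.card * q ^ P.2.card) :=
        Finset.sum_le_sum_of_subset_of_nonneg (Finset.subset_univ _)
          fun _ _ _ => by positivity
    _ = 2 * q * ((q + 1) ^ N * (q + 1) ^ N) := by
        rw [← Finset.mul_sum, ← sum_pow_card_eq, Finset.sum_mul_sum, ← Finset.univ_product_univ,
          Finset.sum_product]
    _ ≤ 2 * (1 / N) * (Real.exp 1 * Real.exp 1) := by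
        gcongr
        rw [hqN]
        refine one_div_le_one_div_of_le hN0 ?_
        nlinarith [(by exact_mod_cast hN : (1 : ℝ) ≤ N)]
    _ = _ := by rw [← Real.exp_add]; norm_num; ring

/-- Outside the two exceptional events, critical pairs have small discrepancy by definition. For the
others the trivial bound `4 D |T|` is already below `α √(|S| |T|)`, so the discrepancy lemma applies
with `R = 4 D`. -/
lemma noise_quad_le {N : ℕ} {p : Fin N → Fin N → ℝ} (hp : IsEdgeProb p) {D α : ℝ}
    (hD : DegreesLE p D) (hD0 : 0 < D) (hα : 0 ≤ α) (hN : 1 ≤ N)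
    (hαD : 64 * D * Real.log N ≤ α ^ 2) (k : ℕ) :
    graphProb p {G | ∃ x, (16 * D / 2 ^ k + 16 * (2 * k + 1) * α) * (x ⬝ᵥ x) <
      |quad (noise p G) x|} ≤ N * Real.exp (- (D / 2)) + 2 * Real.exp 2 / N := by
  refine le_trans (graphProb_mono hp ?_) ((graphProb_union_le hp _ _).trans
    (add_le_add (noise_row_sum_le hp hD) (noise_discrepancy_le hp hD hD0 hα hN hαD)))
  intro G hG
  by_contra hcon
  rw [Set.mem_union, not_or] at hcon
  obtain ⟨h1, h2⟩ := hcon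
  simp only [Set.mem_ofPred_eq, not_exists, not_le, not_and] at h1 h2
  have hsymm := noise_symm hp G
  have hT : ∀ S T : Finset (Fin N), T.card ≤ S.card →
      |∑ i ∈ S, ∑ j ∈ T, noise p G i j| ≤ α * (√S.card * √T.card) := by
    intro S T hle
    by_cases hP : (S, T) ∈ criticalPairs N D α
    · exact (h2 _ hP).le
    · simp only [criticalPairs, Finset.mem_filter, Finset.mem_univ, true_and, not_and, not_le]
        at hP
      have h3 : |∑ i ∈ S, ∑ j ∈ T, noise p G i j| ≤ T.card * (4 * D) := by
        rw [sum_sum_eq_sum_sum_of_symm hsymm, ← nsmul_eq_mul]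
        refine (Finset.abs_sum_le_sum_abs _ _).trans (Finset.sum_le_card_nsmul _ _ _ fun j _ => ?_)
        refine (Finset.abs_sum_le_sum_abs _ _).trans (le_trans ?_ (h1 j).le)
        exact Finset.sum_le_sum_of_subset_of_nonneg (Finset.subset_univ _)
          fun _ _ _ => abs_nonneg _
      by_cases hT1 : 1 ≤ T.card
      · refine h3.trans ?_
        have h4 := mul_le_mul_of_nonneg_right (hP hle hT1).le (Real.sqrt_nonneg T.card)
        have ht := Real.mul_self_sqrt (Nat.cast_nonneg (α := ℝ) T.card)
        calc (T.card : ℝ) * (4 * D) = 4 * D * √T.card * √T.card := by rw [mul_assoc, ht]; ring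
          _ ≤ _ := h4
          _ = _ := by ring
      · have h0 : T.card = 0 := by omega
        rw [h0] at h3
        refine h3.trans ?_
        simp only [Nat.cast_zero, zero_mul]
        positivity
  obtain ⟨x, hx⟩ := hG
  have h := abs_quad_le_of_discrepancy hsymm hα (fun S T => ?_) (fun i => (h1 i).le) k x
  · refine absurd hx (not_lt.2 (h.trans (le_of_eq ?_)))
    ring
  · rcases le_total T.card S.card with hle | hle
    · exact hT S T hle
    · have := hT T S hle
      rwa [sum_sum_eq_sum_sum_of_symm hsymm, mul_comm √(S.card : ℝ)]

/-! ### Row sums of the geometric matrix -/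

/-- The Gaussian kernel. -/
def kernel (γ : ℝ) (x y : EuclideanSpace ℝ (Fin 2)) : ℝ := Real.exp (-γ * ‖x - y‖ ^ 2)

lemma kernel_nonneg (γ : ℝ) (x y : EuclideanSpace ℝ (Fin 2)) : 0 ≤ kernel γ x y :=
  (Real.exp_pos _).le

lemma kernel_le_one {γ : ℝ} (hγ : 0 ≤ γ) (x y : EuclideanSpace ℝ (Fin 2)) :
    kernel γ x y ≤ 1 := by
  unfold kernel
  rw [Real.exp_le_one_iff]
  nlinarith [mul_nonneg hγ (sq_nonneg ‖x - y‖)]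

lemma kernel_comm (γ : ℝ) (x y : EuclideanSpace ℝ (Fin 2)) : kernel γ x y = kernel γ y x := by
  rw [kernel, norm_sub_rev, kernel]

@[fun_prop]
lemma measurable_kernel {α : Type*} [MeasurableSpace α] (γ : ℝ)
    {f g : α → EuclideanSpace ℝ (Fin 2)} (hf : Measurable f) (hg : Measurable g) :
    Measurable fun a => kernel γ (f a) (g a) := by
  unfold kernel
  fun_prop

/-- The normal density is at most `1 / √(2 π)`, and the remaining Gaussian integral is `√(π / γ)`
whatever the centre `a`. In the plane two such factors give `1 / (2 γ)`. -/
lemma integral_exp_gaussianReal_le {γ : ℝ} (hγ : 0 < γ) (a : ℝ) :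
    ∫ t, Real.exp (-γ * (a - t) ^ 2) ∂gaussianReal 0 1 ≤ √(1 / (2 * γ)) := by
  rw [integral_gaussianReal_eq_integral_smul one_ne_zero]
  have hint : Integrable fun t : ℝ => Real.exp (-γ * (a - t) ^ 2) :=
    (integrable_exp_neg_mul_sq hγ).comp_sub_left a
  have h1 : ∫ t, gaussianPDFReal 0 1 t • Real.exp (-γ * (a - t) ^ 2) ≤
      ∫ t, (√(2 * Real.pi))⁻¹ * Real.exp (-γ * (a - t) ^ 2) := by
    refine integral_mono_of_nonneg (ae_of_all _ fun t => ?_) (hint.const_mul _)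
      (ae_of_all _ fun t => ?_)
    · exact smul_nonneg (gaussianPDFReal_nonneg _ _ _) (Real.exp_pos _).le
    · simp only [gaussianPDFReal, smul_eq_mul, NNReal.coe_one, mul_one]
      refine mul_le_mul_of_nonneg_right ?_ (Real.exp_pos _).le
      refine mul_le_of_le_one_right (by positivity) ?_
      rw [Real.exp_le_one_iff]
      have := sq_nonneg (t - 0)
      linarith
  refine h1.trans (le_of_eq ?_)
  rw [integral_const_mul, integral_sub_left_eq_self (fun t => Real.exp (-γ * t ^ 2)) volume a,
    integral_gaussian, ← Real.sqrt_inv, ← Real.sqrt_mul (by positivity)]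
  congr 1
  field_simp

lemma integral_kernel_le {γ : ℝ} (hγ : 0 < γ) (x : EuclideanSpace ℝ (Fin 2)) :
    ∫ y, kernel γ x y ∂stdGaussian (EuclideanSpace ℝ (Fin 2)) ≤ 1 / (2 * γ) := by
  rw [← map_pi_eq_stdGaussian, integral_map (by fun_prop)
    (by exact (measurable_kernel γ measurable_const measurable_id).aestronglyMeasurable)]
  have h1 : ∀ y : Fin 2 → ℝ, kernel γ x (WithLp.toLp 2 y) =
      ∏ i, Real.exp (-γ * (x i - y i) ^ 2) := by
    intro y
    rw [kernel, EuclideanSpace.real_norm_sq_eq, Finset.mul_sum, Real.exp_sum]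
    rfl
  simp_rw [h1]
  rw [integral_fintype_prod_eq_prod (f := fun (i : Fin 2) t => Real.exp (-γ * (x i - t) ^ 2))]
  calc _ ≤ ∏ _i : Fin 2, √(1 / (2 * γ)) :=
        Finset.prod_le_prod (fun i _ => integral_nonneg fun _ => (Real.exp_pos _).le)
          fun i _ => integral_exp_gaussianReal_le hγ _
    _ = _ := by
        rw [Finset.prod_const, Finset.card_univ, Fintype.card_fin, Real.sq_sqrt (by positivity)]

/-- Since the kernel lies in `[0, 1]`, its square is at most itself, so its mean alone controls the
exponential moment. -/
lemma kernel_mgf_le {γ : ℝ} (hγ : 0 < γ) (x : EuclideanSpace ℝ (Fin 2)) {θ : ℝ} (hθ : 0 ≤ θ)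
    (hθ' : θ ≤ 1) :
    ∫ y, Real.exp (θ * kernel γ x y) ∂stdGaussian (EuclideanSpace ℝ (Fin 2)) ≤
      Real.exp ((θ + θ ^ 2) * (1 / (2 * γ))) := by
  have hmeas : Measurable fun y => kernel γ x y := measurable_kernel γ measurable_const measurable_id
  have hint : Integrable (fun y => kernel γ x y) (stdGaussian (EuclideanSpace ℝ (Fin 2))) := by
    refine Integrable.of_bound hmeas.aestronglyMeasurable 1 (ae_of_all _ fun y => ?_)
    rw [Real.norm_of_nonneg (kernel_nonneg _ _ _)]
    exact kernel_le_one hγ.le _ _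
  have h1 : ∀ y, Real.exp (θ * kernel γ x y) ≤ 1 + (θ + θ ^ 2) * kernel γ x y := by
    intro y
    have h0 := kernel_nonneg γ x y
    have h1 := kernel_le_one hγ.le x y
    have h2 : θ * kernel γ x y ≤ 1 := by nlinarith
    refine (exp_le_one_add_add_sq (abs_le.2 ⟨by linarith [mul_nonneg hθ h0], h2⟩)).trans ?_
    have h3 : kernel γ x y ^ 2 ≤ kernel γ x y := by nlinarith
    nlinarith [mul_le_mul_of_nonneg_left h3 (sq_nonneg θ)]
  calc _ ≤ ∫ y, (1 + (θ + θ ^ 2) * kernel γ x y) ∂stdGaussian (EuclideanSpace ℝ (Fin 2)) :=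
        integral_mono_of_nonneg (ae_of_all _ fun _ => (Real.exp_pos _).le)
          ((integrable_const _).add (hint.const_mul _)) (ae_of_all _ h1)
    _ = 1 + (θ + θ ^ 2) * ∫ y, kernel γ x y ∂stdGaussian (EuclideanSpace ℝ (Fin 2)) := by
        rw [integral_add (integrable_const _) (hint.const_mul _), integral_const_mul]
        simp
    _ ≤ 1 + (θ + θ ^ 2) * (1 / (2 * γ)) := by
        gcongr
        exact integral_kernel_le hγ x
    _ ≤ _ := by
        rw [add_comm]; exact Real.add_one_le_exp _

lemma lintegral_exp_sum_kernel_le {n : ℕ} {γ : ℝ} (hγ : 0 < γ) (x : EuclideanSpace ℝ (Fin 2))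
    {θ : ℝ} (hθ : 0 ≤ θ) (hθ' : θ ≤ 1) :
    ∫⁻ y, ENNReal.ofReal (Real.exp (θ * ∑ j, kernel γ x (y j))) ∂positionLaw n ≤
      ENNReal.ofReal (Real.exp (n * ((θ + θ ^ 2) * (1 / (2 * γ))))) := by
  have : IsProbabilityMeasure (positionLaw n) := by unfold positionLaw; infer_instance
  have hint : Integrable (fun y : Positions n => Real.exp (θ * ∑ j, kernel γ x (y j)))
      (positionLaw n) := by
    refine Integrable.of_bound (Measurable.aestronglyMeasurable (by fun_prop)) (Real.exp (θ * n))
      (ae_of_all _ fun y => ?_)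
    rw [Real.norm_of_nonneg (Real.exp_pos _).le]
    gcongr
    refine (Finset.sum_le_card_nsmul _ _ 1 fun j _ => kernel_le_one hγ.le _ _).trans ?_
    simp
  rw [← ofReal_integral_eq_lintegral_ofReal hint (ae_of_all _ fun _ => (Real.exp_pos _).le)]
  refine ENNReal.ofReal_le_ofReal ?_
  simp_rw [Finset.mul_sum, Real.exp_sum]
  rw [positionLaw, integral_fintype_prod_eq_prod (f := fun (_ : Fin n) y => Real.exp (θ * kernel γ x y))]
  rw [Real.exp_nat_mul]
  refine (Finset.prod_le_prod (fun i _ => integral_nonneg fun _ => (Real.exp_pos _).le)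
    fun i _ => kernel_mgf_le hγ x hθ hθ').trans ?_
  simp

/-- Chernoff's bound for the number of neighbours of a given position. -/
lemma positionLaw_row_tail_le {N : ℕ} {γ : ℝ} (hγ : 0 < γ) (i : Fin N) {η : ℝ} (hη : 0 ≤ η)
    (hη' : η ≤ 1) :
    positionLaw N {X | (1 + η) * (N / (2 * γ)) ≤ ∑ j, if i = j then 0 else kernel γ (X i) (X j)} ≤
      ENNReal.ofReal (Real.exp (- (η ^ 2 / 8 * (N / γ)))) := by
  obtain _ | n := N
  · exact i.elim0
  -- This `θ` minimizes `(θ + θ ^ 2) - θ (1 + η)`, with value `- η ^ 2 / 4`; multiplied by `N / (2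
  -- γ)` it is the claimed exponent.
  set θ := η / 2 with hθ
  set m := 1 / (2 * γ) with hm
  have hm0 : 0 < m := by positivity
  set F : Positions (n + 1) → ENNReal :=
    fun X => ENNReal.ofReal (Real.exp (θ * ∑ j, if i = j then 0 else kernel γ (X i) (X j))) with hF
  have hFmeas : Measurable F := by
    refine ENNReal.measurable_ofReal.comp (Real.measurable_exp.comp (measurable_const.mul ?_))
    refine Finset.measurable_sum _ fun j _ => ?_
    split_ifs
    · exact measurable_const
    · fun_prop
  have hprob : IsProbabilityMeasure (positionLaw n) := by unfold positionLaw; infer_instance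
  have h1 : ∫⁻ X, F X ∂positionLaw (n + 1) ≤
      ENNReal.ofReal (Real.exp (n * ((θ + θ ^ 2) * m))) := by
    have hmp := (measurePreserving_piFinSuccAbove
      (fun _ : Fin (n + 1) => stdGaussian (EuclideanSpace ℝ (Fin 2))) i).symm
    -- The `i`-th position is integrated last: once it is fixed at `x`, the kernels to the other
    -- points are independent, and the bound is uniform in `x`.
    rw [positionLaw, ← hmp.lintegral_comp hFmeas, lintegral_prod _
      (by exact (hFmeas.comp hmp.measurable).aemeasurable)]
    have h2 : ∀ x, ∫⁻ y, F ((MeasurableEquiv.piFinSuccAbove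
        (fun _ : Fin (n + 1) => EuclideanSpace ℝ (Fin 2)) i).symm (x, y)) ∂positionLaw n ≤
        ENNReal.ofReal (Real.exp (n * ((θ + θ ^ 2) * m))) := by
      intro x
      refine le_trans (le_of_eq ?_) (lintegral_exp_sum_kernel_le hγ x (by positivity : 0 ≤ θ)
        (by rw [hθ]; linarith))
      refine lintegral_congr fun y => ?_
      simp only [hF, MeasurableEquiv.piFinSuccAbove_symm_apply, Fin.insertNthEquiv, Equiv.coe_fn_mk]
      rw [Fin.sum_univ_succAbove _ i]
      simp [Fin.ne_succAbove]
    refine (lintegral_mono h2).trans ?_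
    simp
  have h3 : positionLaw (n + 1) {X | (1 + η) * (((n + 1 : ℕ) : ℝ) / (2 * γ)) ≤
      ∑ j, if i = j then 0 else kernel γ (X i) (X j)} ≤
      positionLaw (n + 1) {X | ENNReal.ofReal (Real.exp (θ * ((1 + η) * ((n + 1 : ℕ) * m)))) ≤ F X} := by
    refine measure_mono fun X hX => ?_
    refine ENNReal.ofReal_le_ofReal (Real.exp_le_exp.2 (mul_le_mul_of_nonneg_left ?_ (by positivity)))
    rw [hm, mul_one_div]
    exact hX
  refine h3.trans ((meas_ge_le_lintegral_div hFmeas.aemeasurable ?_ ENNReal.ofReal_ne_top).trans ?_)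
  · simp [Real.exp_pos]
  · rw [ENNReal.div_le_iff (by simp [Real.exp_pos]) ENNReal.ofReal_ne_top,
      ← ENNReal.ofReal_mul (Real.exp_pos _).le, ← Real.exp_add]
    refine h1.trans (ENNReal.ofReal_le_ofReal (Real.exp_le_exp.2 ?_))
    have h4 : ((n + 1 : ℕ) : ℝ) / γ = 2 * ((n + 1 : ℕ) * m) := by rw [hm]; field_simp
    rw [h4, hθ]
    push_cast
    have : 0 ≤ (η / 2 + (η / 2) ^ 2) * m := by positivity
    nlinarith

lemma positionLaw_rows_tail_le {N : ℕ} {γ : ℝ} (hγ : 0 < γ) {η : ℝ} (hη : 0 ≤ η) (hη' : η ≤ 1) :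
    positionLaw N {X | ∀ i, ∑ j, (if i = j then 0 else kernel γ (X i) (X j)) ≤
      (1 + η) * (N / (2 * γ))}ᶜ ≤
      ENNReal.ofReal (N * Real.exp (- (η ^ 2 / 8 * (N / γ)))) := by
  have h : {X : Positions N | ∀ i, ∑ j, (if i = j then 0 else kernel γ (X i) (X j)) ≤
      (1 + η) * (N / (2 * γ))}ᶜ ⊆ ⋃ i, {X | (1 + η) * (N / (2 * γ)) ≤
        ∑ j, if i = j then 0 else kernel γ (X i) (X j)} := by
    intro X hX
    simp only [Set.mem_compl_iff, Set.mem_ofPred_eq, not_forall, not_le] at hX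
    obtain ⟨i, hi⟩ := hX
    exact Set.mem_iUnion.2 ⟨i, hi.le⟩
  refine (measure_mono h).trans ((measure_iUnion_fintype_le _ _).trans ?_)
  refine (Finset.sum_le_sum fun i _ => positionLaw_row_tail_le hγ i hη hη').trans ?_
  rw [Finset.sum_const, Finset.card_univ, Fintype.card_fin, nsmul_eq_mul,
    ENNReal.ofReal_mul (Nat.cast_nonneg _), ENNReal.ofReal_natCast]

/-! ### The law of the model -/

lemma geomMatrix_eq {N : ℕ} (θ : Params) (X : Positions N) (i j : Fin N) :
    geomMatrix θ X i j = θ.κ * if i = j then 0 else kernel θ.γ (X i) (X j) := by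
  simp only [geomMatrix, Matrix.of_apply, kernel]
  split_ifs <;> simp

lemma geomMatrix_symm {N : ℕ} (θ : Params) (X : Positions N) (i j : Fin N) :
    geomMatrix θ X i j = geomMatrix θ X j i := by
  rw [geomMatrix_eq, geomMatrix_eq, kernel_comm]
  simp only [eq_comm]

lemma geomMatrix_nonneg {N : ℕ} (θ : Params) (X : Positions N) (i j : Fin N) :
    0 ≤ geomMatrix θ X i j := by
  rw [geomMatrix_eq]
  refine mul_nonneg θ.κ_nonneg ?_
  split_ifs
  exacts [le_rfl, kernel_nonneg _ _ _]

lemma geomMatrix_le {N : ℕ} (θ : Params) (X : Positions N) (i j : Fin N) :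
    geomMatrix θ X i j ≤ θ.κ := by
  rw [geomMatrix_eq]
  refine mul_le_of_le_one_right θ.κ_nonneg ?_
  split_ifs
  exacts [zero_le_one, kernel_le_one θ.γ_nonneg _ _]

lemma geomMatrix_isHermitian {N : ℕ} (θ : Params) (X : Positions N) :
    (geomMatrix θ X).IsHermitian :=
  Matrix.IsHermitian.ext fun i j => by simpa using geomMatrix_symm θ X j i

lemma isEdgeProb_edgeProb {N : ℕ} (θ : Params) (c : Fin N → Bool) (X : Positions N) :
    IsEdgeProb (edgeProb θ c X) where
  nonneg i j _ := by
    refine add_nonneg (geomMatrix_nonneg θ X i j) ?_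
    split_ifs
    exacts [θ.p₁_pos.le, θ.p₂_pos.le]
  le_one i j _ := by
    refine le_trans ?_ θ.max_add_le_one
    rw [edgeProb, add_comm]
    refine add_le_add ?_ (geomMatrix_le θ X i j)
    split_ifs
    exacts [le_max_left _ _, le_max_right _ _]
  symm i j := by
    simp only [edgeProb, geomMatrix_symm θ X i j, eq_comm]

instance {N : ℕ} : IsProbabilityMeasure (positionLaw N) := by
  unfold positionLaw; infer_instance

instance {V : Type*} [Countable V] : MeasurableSingletonClass (SimpleGraph V) where
  measurableSet_singleton G := by
    have : {G} = ⋂ u : V, ⋂ v : V, {H : SimpleGraph V | H.Adj u v ↔ G.Adj u v} := by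
      ext H
      simp only [Set.mem_singleton_iff, Set.mem_iInter, Set.mem_ofPred_eq]
      exact ⟨fun h => h ▸ fun _ _ => Iff.rfl, fun h => SimpleGraph.ext (by ext u v; exact h u v)⟩
    rw [this]
    refine MeasurableSet.iInter fun u => MeasurableSet.iInter fun v => ?_
    have hm := SimpleGraph.measurable_iff_adj.1 (measurable_id (α := SimpleGraph V)) u v
    exact measurableSet_setOfPred.2 (hm.iff measurable_const)

lemma graphWeight_eq {N : ℕ} (θ : Params) (c : Fin N → Bool) (X : Positions N)
    (G : SimpleGraph (Fin N)) : graphWeight θ c X G = bernoulliWeight (edgeProb θ c X) G := rfl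

lemma measurable_graphWeight {N : ℕ} (θ : Params) (c : Fin N → Bool) (G : SimpleGraph (Fin N)) :
    Measurable fun X => graphWeight θ c X G := by
  have h : ∀ i j, Measurable fun X : Positions N => edgeProb θ c X i j := by
    intro i j
    simp only [edgeProb, geomMatrix_eq]
    refine Measurable.add_const (measurable_const.mul ?_) _
    split_ifs
    · exact measurable_const
    · fun_prop
  unfold graphWeight
  refine Finset.measurable_prod _ fun e _ => ?_
  split_ifs
  · exact h _ _
  · exact measurable_const.sub (h _ _)

lemma modelLaw_graph_event {N : ℕ} (θ : Params) (c : Fin N → Bool)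
    (S : Set (SimpleGraph (Fin N))) :
    modelLaw θ c {ω | ω.2 ∈ S} =
      ∫⁻ X, ENNReal.ofReal (graphProb (edgeProb θ c X) S) ∂positionLaw N := by
  classical
  have hS : MeasurableSet S := S.toFinite.measurableSet
  have hSm : MeasurableSet {ω : Positions N × SimpleGraph (Fin N) | ω.2 ∈ S} := measurable_snd hS
  have hmeas : Measurable fun ω : Positions N × SimpleGraph (Fin N) =>
      ENNReal.ofReal (graphWeight θ c ω.1 ω.2) :=
    measurable_from_prod_countable_left fun G =>
      (measurable_graphWeight θ c G).ennreal_ofReal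
  rw [modelLaw, withDensity_apply _ hSm, ← lintegral_indicator hSm,
    lintegral_prod _ (hmeas.indicator hSm).aemeasurable]
  refine lintegral_congr fun X => ?_
  rw [lintegral_count, tsum_fintype, graphProb, ENNReal.ofReal_sum_of_nonneg fun G _ =>
    Set.indicator_nonneg (fun _ _ => bernoulliWeight_nonneg (isEdgeProb_edgeProb θ c X) _) _]
  refine Finset.sum_congr rfl fun G _ => ?_
  by_cases hG : G ∈ S
  · rw [Set.indicator_of_mem (by exact hG), Set.indicator_of_mem hG, graphWeight_eq]
  · rw [Set.indicator_of_notMem (by exact hG), Set.indicator_of_notMem hG, ENNReal.ofReal_zero]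

lemma measurable_graphProb {N : ℕ} (θ : Params) (c : Fin N → Bool)
    (S : Set (SimpleGraph (Fin N))) : Measurable fun X => graphProb (edgeProb θ c X) S := by
  unfold graphProb
  refine Finset.measurable_sum _ fun G _ => ?_
  by_cases hG : G ∈ S
  · simp only [Set.indicator_of_mem hG]
    exact measurable_graphWeight θ c G
  · simp only [Set.indicator_of_notMem hG]
    exact measurable_const

/-- Markov's inequality for the measurable conditional probability of `S`, whose superlevel set
contains `E`; no measurability of `E` itself is required. -/
lemma le_modelLaw {N : ℕ} (θ : Params) (c : Fin N → Bool) (S : Set (SimpleGraph (Fin N)))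
    (E : Set (Positions N)) {ε : ℝ} (h : ∀ X ∈ E, graphProb (edgeProb θ c X) Sᶜ ≤ ε) :
    ENNReal.ofReal (1 - ε) * positionLaw N E ≤ modelLaw θ c {ω | ω.2 ∈ S} := by
  rw [modelLaw_graph_event]
  refine le_trans ?_ (mul_meas_ge_le_lintegral (measurable_graphProb θ c S).ennreal_ofReal
    (ENNReal.ofReal (1 - ε)))
  refine mul_le_mul_right (measure_mono fun X hX => ?_) _
  refine ENNReal.ofReal_le_ofReal ?_
  have := h X hX
  rw [graphProb_compl] at this
  linarith

lemma modelLaw_le_one {N : ℕ} (θ : Params) (c : Fin N → Bool) (S : Set (SimpleGraph (Fin N))) :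
    modelLaw θ c {ω | ω.2 ∈ S} ≤ 1 := by
  rw [modelLaw_graph_event]
  calc _ ≤ ∫⁻ _X, 1 ∂positionLaw N := by
        refine lintegral_mono fun X => ENNReal.ofReal_le_one.2 ?_
        have := graphProb_nonneg (isEdgeProb_edgeProb θ c X) Sᶜ
        rw [graphProb_compl] at this
        linarith
    _ = 1 := by simp

lemma tendsto_modelLaw {θ : ℕ → Params} {c : ∀ n : ℕ, Fin (2 * n) → Bool}
    {S : ∀ n, Set (SimpleGraph (Fin (2 * n)))} {E : ∀ n, Set (Positions (2 * n))}
    (hE : Tendsto (fun n => positionLaw (2 * n) (E n)) atTop (𝓝 1)) {ε : ℕ → ℝ}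
    (hε : Tendsto ε atTop (𝓝 0))
    (h : ∀ᶠ n in atTop, ∀ X ∈ E n, graphProb (edgeProb (θ n) (c n) X) (S n)ᶜ ≤ ε n) :
    Tendsto (fun n => modelLaw (θ n) (c n) {ω | ω.2 ∈ S n}) atTop (𝓝 1) := by
  have h1 : Tendsto (fun n => ENNReal.ofReal (1 - ε n) * positionLaw (2 * n) (E n)) atTop
      (𝓝 1) := by
    have h2 : Tendsto (fun n => ENNReal.ofReal (1 - ε n)) atTop (𝓝 1) := by
      simpa using ENNReal.tendsto_ofReal (tendsto_const_nhds (x := (1 : ℝ)).sub hε)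
    simpa using ENNReal.Tendsto.mul h2 (Or.inl one_ne_zero) hE (Or.inl one_ne_zero)
  exact tendsto_of_tendsto_of_tendsto_of_le_of_le' h1 tendsto_const_nhds
    (h.mono fun n hn => le_modelLaw _ _ _ _ hn) (Eventually.of_forall fun n => modelLaw_le_one _ _ _)

/-! ### Correlation with the communities -/

lemma communityVec_eq {N : ℕ} (c : Fin N → Bool) : communityVec c = (1 / √N) • pm c := by
  ext i
  simp only [communityVec, pm, Pi.smul_apply, smul_eq_mul]
  ring

lemma communityVec_dotProduct_self {N : ℕ} (hN : 0 < N) (c : Fin N → Bool) :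
    communityVec c ⬝ᵥ communityVec c = 1 := by
  have h : ∀ i, communityVec c i * communityVec c i = 1 / N := by
    intro i
    rw [communityVec, div_mul_div_comm, Real.mul_self_sqrt (Nat.cast_nonneg _)]
    split_ifs <;> norm_num
  rw [dotProduct, Finset.sum_congr rfl fun i _ => h i]
  have : (N : ℝ) ≠ 0 := by positivity
  simp [this]

lemma isNormalizedSignVec_communityVec {N : ℕ} (c : Fin N → Bool) :
    IsNormalizedSignVec (communityVec c) := by
  intro i
  unfold communityVec
  split_ifs
  exacts [Or.inl rfl, Or.inr rfl]

lemma isNormalizedSignVec_signVec {N : ℕ} (x : Fin N → ℝ) : IsNormalizedSignVec (signVec x) := by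
  intro i
  unfold signVec
  split_ifs
  exacts [Or.inl rfl, Or.inr rfl]

lemma quad_smul {N : ℕ} (M : Matrix (Fin N) (Fin N) ℝ) (a : ℝ) (x : Fin N → ℝ) :
    quad M (a • x) = a ^ 2 * quad M x := by
  simp only [quad, Pi.smul_apply, smul_eq_mul, Finset.mul_sum]
  exact Finset.sum_congr rfl fun i _ => Finset.sum_congr rfl fun j _ => by ring

lemma quad_communityVec {N : ℕ} (M : Matrix (Fin N) (Fin N) ℝ) (c : Fin N → Bool) :
    quad M (communityVec c) = quad M (pm c) / N := by
  rw [communityVec_eq, quad_smul, div_pow, Real.sq_sqrt (Nat.cast_nonneg _)]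
  ring

/-- Off the diagonal this is the conditional mean plus noise. On the diagonal `A` vanishes while `λ₂
σ σᵀ - λ₁ v₁ v₁ᵀ` would need `-p₂`: the correction `-p₁` accounts for the gap `-(p₁ + p₂) / 2 = (p₁
- p₂) / 2 - p₁`, and it is constant on unit vectors. -/
lemma quad_shiftedAdj {N : ℕ} (hN : 0 < N) (θ : Params) (c : Fin N → Bool) (X : Positions N)
    (G : SimpleGraph (Fin N)) (x : Fin N → ℝ) :
    quad (shiftedAdj G (lam₁ N θ)) x = quad (noise (edgeProb θ c X) G) x +
      quad (geomMatrix θ X) x + lam₂ N θ * (communityVec c ⬝ᵥ x) ^ 2 - θ.p₁ * (x ⬝ᵥ x) := by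
  classical
  have hN' : (N : ℝ) ≠ 0 := by positivity
  have hsq : √(N : ℝ) * √N = N := Real.mul_self_sqrt (Nat.cast_nonneg _)
  have hentry : ∀ i j, shiftedAdj G (lam₁ N θ) i j = noise (edgeProb θ c X) G i j +
      geomMatrix θ X i j + lam₂ N θ * (communityVec c i * communityVec c j) -
      if i = j then θ.p₁ else 0 := by
    intro i j
    have h1 : lam₂ N θ * (communityVec c i * communityVec c j) =
        if c i = c j then (θ.p₁ - θ.p₂) / 2 else - ((θ.p₁ - θ.p₂) / 2) := by
      rw [communityVec, communityVec, div_mul_div_comm, hsq, lam₂]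
      cases c i <;> cases c j <;> simp <;> field_simp
    have h2 : lam₁ N θ * (1 / √N * (1 / √N)) = (θ.p₁ + θ.p₂) / 2 := by
      rw [div_mul_div_comm, hsq, lam₁]
      field_simp
    simp only [shiftedAdj, Matrix.sub_apply, Matrix.smul_apply, Matrix.vecMulVec_apply,
      smul_eq_mul, h1, h2, noise, Matrix.of_apply, SimpleGraph.adjMatrix_apply, edgeProb]
    by_cases hij : i = j
    · subst hij
      simp [geomMatrix]
      ring
    · simp only [hij, if_false]
      by_cases hc : c i = c j
      · simp only [hc, if_true]; ring
      · simp only [hc, if_false]; ring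
  have h3 : (communityVec c ⬝ᵥ x) ^ 2 =
      ∑ i, ∑ j, (communityVec c i * communityVec c j) * (x i * x j) := by
    rw [sq, dotProduct, Finset.sum_mul_sum]
    exact Finset.sum_congr rfl fun i _ => Finset.sum_congr rfl fun j _ => by ring
  have h4 : x ⬝ᵥ x = ∑ i, ∑ j, (if i = j then 1 else 0) * (x i * x j) := by
    simp [dotProduct]
  rw [h3, h4]
  simp only [quad, Finset.mul_sum, ← Finset.sum_add_distrib, ← Finset.sum_sub_distrib]
  refine Finset.sum_congr rfl fun i _ => Finset.sum_congr rfl fun j _ => ?_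
  rw [hentry]
  split_ifs <;> ring

/-- A vector whose quadratic form is at least that of the community vector is correlated with the
community vector. -/
lemma correlation_of_quad_le {N : ℕ} (hN : 0 < N) {θ : Params} {c : Fin N → Bool}
    {X : Positions N} {G : SimpleGraph (Fin N)} {x : Fin N → ℝ} (hx : x ⬝ᵥ x = 1) {ρ τ : ℝ}
    (hρ : ∀ y, |quad (geomMatrix θ X) y| ≤ ρ * (y ⬝ᵥ y))
    (hτx : |quad (noise (edgeProb θ c X) G) x| ≤ τ)
    (hτc : |quad (noise (edgeProb θ c X) G) (communityVec c)| ≤ τ)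
    (hle : quad (shiftedAdj G (lam₁ N θ)) (communityVec c) ≤
      quad (shiftedAdj G (lam₁ N θ)) x) :
    lam₂ N θ - 2 * (ρ + τ) ≤ lam₂ N θ * (communityVec c ⬝ᵥ x) ^ 2 := by
  have hc := communityVec_dotProduct_self hN c
  rw [quad_shiftedAdj hN θ c X, quad_shiftedAdj hN θ c X, hx, hc] at hle
  have h1 := hρ x
  have h2 := hρ (communityVec c)
  rw [hx] at h1
  rw [hc] at h2
  rw [abs_le] at h1 h2 hτx hτc
  linarith [h1.2, h2.1, hτx.2, hτc.1]

/-- Here `(1 + w) / 2` is the indicator of the indices with `w = 1`. Dropping the other terms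
increases the sum, and Cauchy–Schwarz bounds its square by the number of those indices. -/
lemma sign_agreement {ι : Type*} [Fintype ι] [Nonempty ι] {w y : ι → ℝ} (hw : ∀ i, w i ^ 2 = 1)
    (hy : ∀ i, 0 ≤ y i) (hy1 : ∑ i, y i ^ 2 = 1) (h0 : 0 ≤ ∑ i, w i * y i) :
    2 * ((∑ i, w i * y i) ^ 2 / Fintype.card ι) - 1 ≤ (∑ i, w i) / Fintype.card ι := by
  have h1 : ∑ i, w i * y i ≤ ∑ i, (1 + w i) / 2 * y i := by
    refine Finset.sum_le_sum fun i _ => mul_le_mul_of_nonneg_right ?_ (hy i)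
    nlinarith [hw i]
  have h2 := Finset.sum_mul_sq_le_sq_mul_sq Finset.univ (fun i => (1 + w i) / 2) y
  rw [hy1, mul_one] at h2
  have h3 : ∑ i, ((1 + w i) / 2) ^ 2 = (Fintype.card ι + ∑ i, w i) / 2 := by
    have : ∀ i, ((1 + w i) / 2) ^ 2 = (1 + w i) / 2 := fun i => by nlinarith [hw i]
    simp_rw [this, ← Finset.sum_div, Finset.sum_add_distrib]
    simp
  have h4 : (∑ i, w i * y i) ^ 2 ≤ (Fintype.card ι + ∑ i, w i) / 2 := by
    rw [← h3]
    exact (pow_le_pow_left₀ h0 h1 2).trans h2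
  have hN : (0 : ℝ) < Fintype.card ι := by exact_mod_cast Fintype.card_pos
  rw [mul_div_assoc', sub_le_iff_le_add, div_le_iff₀ hN, add_mul, div_mul_cancel₀ _ hN.ne']
  linarith

lemma correlation_signVec {N : ℕ} (hN : 0 < N) (c : Fin N → Bool) {x : Fin N → ℝ}
    (hx : x ⬝ᵥ x = 1) :
    2 * (communityVec c ⬝ᵥ x) ^ 2 - 1 ≤ |communityVec c ⬝ᵥ signVec x| := by
  have : Nonempty (Fin N) := ⟨⟨0, hN⟩⟩
  have hN' : (N : ℝ) ≠ 0 := by positivity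
  have hsq : √(N : ℝ) * √N = N := Real.mul_self_sqrt (Nat.cast_nonneg _)
  set s : Fin N → ℝ := fun i => if 0 ≤ x i then 1 else -1 with hs
  set w : Fin N → ℝ := fun i => pm c i * s i with hw
  have hs2 : ∀ i, s i ^ 2 = 1 := fun i => by simp only [hs]; split_ifs <;> norm_num
  have hw2 : ∀ i, w i ^ 2 = 1 := by
    intro i
    rw [hw, mul_pow, hs2, ← sq_abs, abs_pm]; norm_num
  have hy1 : ∑ i, |x i| ^ 2 = 1 := by
    rw [← hx, dotProduct]
    exact Finset.sum_congr rfl fun i _ => by rw [sq_abs, sq]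
  have h1 : ∀ i, s i * |x i| = x i := by
    intro i
    simp only [hs]
    split_ifs with h
    · rw [abs_of_nonneg h, one_mul]
    · rw [abs_of_neg (not_le.1 h)]; ring
  have h2 : (communityVec c ⬝ᵥ x) ^ 2 = (∑ i, w i * |x i|) ^ 2 / N := by
    have : communityVec c ⬝ᵥ x = (∑ i, w i * |x i|) / √N := by
      rw [communityVec_eq, smul_dotProduct, smul_eq_mul, one_div_mul_eq_div, dotProduct]
      congr 1
      exact Finset.sum_congr rfl fun i _ => by rw [hw, mul_assoc, h1]
    rw [this, div_pow, Real.sq_sqrt (Nat.cast_nonneg _)]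
  have h3 : communityVec c ⬝ᵥ signVec x = (∑ i, w i) / N := by
    rw [dotProduct, Finset.sum_div]
    refine Finset.sum_congr rfl fun i _ => ?_
    simp only [communityVec, signVec, hw, hs, pm]
    rw [div_mul_div_comm, hsq]
  rw [h2, h3]
  rcases le_total 0 (∑ i, w i * |x i|) with h | h
  · have := sign_agreement hw2 (fun i => abs_nonneg (x i)) hy1 h
    rw [Fintype.card_fin] at this
    exact this.trans (le_abs_self _)
  · have := sign_agreement (w := fun i => - w i) (fun i => by rw [neg_sq]; exact hw2 i)
      (fun i => abs_nonneg (x i)) hy1 (by simpa [Finset.sum_neg_distrib] using h)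
    simp only [neg_mul, Finset.sum_neg_distrib, neg_sq, Fintype.card_fin, neg_div] at this
    exact this.trans (neg_le_abs _)

/-! ### The asymptotic regime -/

/-- Positions whose row sums are close to their mean and whose geometric matrix is dominated by the
community structure. -/
def goodPositions (N : ℕ) (θ : Params) (η : ℝ) : Set (Positions N) :=
  {X | (∀ i, ∑ j, (if i = j then 0 else kernel θ.γ (X i) (X j)) ≤ (1 + η) * (N / (2 * θ.γ))) ∧
    ∀ x, |quad (geomMatrix θ X) x| ≤ lam₂ N θ / (4 * (1 + η)) * (x ⬝ᵥ x)}

/-- The bounds on the parameters that hold for large `N`. -/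
structure Regime (N : ℕ) (θ : Params) (a : ℝ) : Prop where
  N_pos : 0 < N
  γ_pos : 0 < θ.γ
  lam₁_pos : 0 < lam₁ N θ
  mul_lam₁_le : a * lam₁ N θ ≤ lam₂ N θ
  lam₂_le : lam₂ N θ ≤ lam₁ N θ
  κ_le : θ.κ * N / (2 * θ.γ) ≤ lam₂ N θ

lemma lam₁_pos {N : ℕ} (hN : 0 < N) (θ : Params) : 0 < lam₁ N θ := by
  have := θ.p₁_pos
  have := θ.p₂_pos
  unfold lam₁
  positivity

lemma exists_regime {θ : ℕ → Params} (h1 : H₁ θ) (h2 : H₂ θ) :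
    ∃ a, 0 < a ∧ a ≤ 1 ∧ ∀ᶠ n in atTop, Regime (2 * n) (θ n) a := by
  obtain ⟨⟨a, b, ha, hb, hev⟩, -⟩ := h2
  have key : ∀ᶠ n in atTop, Regime (2 * n) (θ n) a := by
    filter_upwards [hev, eventually_gt_atTop 0, h1.1.eventually_gt_atTop 0] with n hn hn0 hγ
    obtain ⟨⟨-, hκ⟩, hlo, hhi⟩ := hn
    have hpos := lam₁_pos (show 0 < 2 * n by omega) (θ n)
    rw [le_div_iff₀ hpos] at hlo
    rw [div_le_iff₀ hpos] at hhi
    have h2pos : 0 < lam₂ (2 * n) (θ n) := lt_of_lt_of_le (by positivity) hlo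
    rw [inv_mul_le_iff₀ h2pos] at hκ
    exact ⟨by omega, hγ, hpos, hlo, by nlinarith, by nlinarith⟩
  refine ⟨a, ha, ?_, key⟩
  obtain ⟨n, hn, -⟩ := (hev.and key).exists
  exact (hn.2.1.trans hn.2.2).trans hb.le

lemma tendsto_lam₁ {θ : ℕ → Params} (h1 : H₁ θ) (h2 : H₂ θ) :
    Tendsto (fun n => lam₁ (2 * n) (θ n)) atTop atTop := by
  obtain ⟨a, -, -, hreg⟩ := exists_regime h1 h2
  have h : Tendsto (fun n => √(lam₁ (2 * n) (θ n))) atTop atTop := by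
    refine tendsto_atTop_mono' _ ?_ h2.2
    filter_upwards [hreg] with n hn
    rw [div_le_iff₀ (Real.sqrt_pos.2 hn.lam₁_pos), Real.mul_self_sqrt hn.lam₁_pos.le]
    exact hn.lam₂_le
  refine (tendsto_atTop_mono' _ ?_ (tendsto_id.atTop_mul_atTop₀ tendsto_id |>.comp h))
  filter_upwards [hreg] with n hn
  simp only [Function.comp, id]
  rw [Real.mul_self_sqrt hn.lam₁_pos.le]

lemma tendsto_of_compl_le {E : ∀ n, Set (Positions (2 * n))} {ε : ℕ → ENNReal}
    (hε : Tendsto ε atTop (𝓝 0)) (h : ∀ᶠ n in atTop, positionLaw (2 * n) (E n)ᶜ ≤ ε n) :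
    Tendsto (fun n => positionLaw (2 * n) (E n)) atTop (𝓝 1) := by
  have h1 : Tendsto (fun n => 1 - ε n) atTop (𝓝 1) := by
    simpa using ENNReal.Tendsto.sub tendsto_const_nhds hε (Or.inl ENNReal.one_ne_top)
  refine tendsto_of_tendsto_of_tendsto_of_le_of_le' h1 tendsto_const_nhds ?_
    (Eventually.of_forall fun n => prob_le_one)
  filter_upwards [h] with n hn
  rw [tsub_le_iff_right]
  calc (1 : ENNReal) = positionLaw (2 * n) (E n ∪ (E n)ᶜ) := by simp
    _ ≤ _ := (measure_union_le _ _).trans (by gcongr)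

lemma tendsto_two_mul_atTop : Tendsto (fun n : ℕ => ((2 * n : ℕ) : ℝ)) atTop atTop :=
  tendsto_natCast_atTop_atTop.comp
    (tendsto_atTop_mono (fun n => by change n ≤ 2 * n; omega) tendsto_id)

lemma tendsto_rows {θ : ℕ → Params} (h1 : H₁ θ) {η : ℝ} (hη : 0 < η) (hη' : η ≤ 1) :
    Tendsto (fun n => positionLaw (2 * n) {X | ∀ i,
      ∑ j, (if i = j then 0 else kernel (θ n).γ (X i) (X j)) ≤
        (1 + η) * ((2 * n : ℕ) / (2 * (θ n).γ))}) atTop (𝓝 1) := by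
  refine tendsto_of_compl_le (ε := fun n => ENNReal.ofReal (1 / ((2 * n : ℕ) : ℝ))) ?_ ?_
  · have := ENNReal.tendsto_ofReal (tendsto_two_mul_atTop.const_div_atTop 1)
    simpa using this
  · filter_upwards [h1.1.eventually_gt_atTop 0, eventually_gt_atTop 0,
      h1.2.eventually_ge_atTop (16 / η ^ 2)] with n hγ hn hlog
    refine (positionLaw_rows_tail_le hγ hη.le hη').trans (ENNReal.ofReal_le_ofReal ?_)
    have hN : (1 : ℝ) < ((2 * n : ℕ) : ℝ) := by exact_mod_cast (by omega : 1 < 2 * n)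
    set N : ℝ := ((2 * n : ℕ) : ℝ)
    have hL : 0 < Real.log N := Real.log_pos hN
    have h3 : 2 * Real.log N ≤ η ^ 2 / 8 * (N / (θ n).γ) := by
      rw [div_le_iff₀ (by positivity)] at hlog
      have h4 : 1 / (θ n).γ * (N / Real.log N) * η ^ 2 =
        (η ^ 2 * (N / (θ n).γ)) / Real.log N := by ring
      rw [h4, le_div_iff₀ hL] at hlog
      linarith
    calc N * Real.exp (-(η ^ 2 / 8 * (N / (θ n).γ))) ≤ N * Real.exp (-(2 * Real.log N)) := by
          gcongr
      _ = 1 / N := by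
          rw [Real.exp_neg, mul_comm (2 : ℝ), Real.exp_mul, Real.exp_log (by positivity)]
          norm_cast
          rw [sq]
          field_simp

lemma sum_abs_geomMatrix_row {N : ℕ} (θ : Params) (X : Positions N) (i : Fin N) :
    ∑ j, |geomMatrix θ X i j| = θ.κ * ∑ j, if i = j then 0 else kernel θ.γ (X i) (X j) := by
  rw [Finset.mul_sum]
  refine Finset.sum_congr rfl fun j _ => ?_
  rw [abs_of_nonneg (geomMatrix_nonneg θ X i j), geomMatrix_eq]

lemma dotProduct_self_nonneg_real {N : ℕ} (x : Fin N → ℝ) : 0 ≤ x ⬝ᵥ x :=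
  Finset.sum_nonneg fun i _ => mul_self_nonneg (x i)

lemma exists_tendsto_goodPositions {θ : ℕ → Params} (h1 : H₁ θ) (h2 : H₂ θ)
    (hsep : ∃ ε > 0, Separated θ ε) :
    ∃ η, 0 < η ∧ η ≤ 1 ∧
      Tendsto (fun n => positionLaw (2 * n) (goodPositions (2 * n) (θ n) η)) atTop (𝓝 1) := by
  obtain ⟨ε, hε, hsep⟩ := hsep
  obtain ⟨a, ha, -, hreg⟩ := exists_regime h1 h2
  -- Ensures `(1 + η) ^ 2 ≤ 1 + ε`: one factor `1 + η` is lost in the row sums, the other is kept as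
  -- slack.
  set η := min 1 (ε / 3) with hη
  have hη0 : 0 < η := by positivity
  have hη1 : η ≤ 1 := min_le_left _ _
  have hη2 : η ≤ ε / 3 := min_le_right _ _
  refine ⟨η, hη0, hη1, ?_⟩
  have hrows := tendsto_rows h1 hη0 hη1
  rcases hsep with hsep | hsep
  · refine tendsto_of_tendsto_of_tendsto_of_le_of_le' hrows tendsto_const_nhds ?_
      (Eventually.of_forall fun n => prob_le_one)
    filter_upwards [hsep, hreg] with n hn hr
    refine measure_mono fun X hX => ⟨hX, fun x => ?_⟩
    refine abs_quad_le_of_row_sum_le (geomMatrix_symm (θ n) X) (fun i => ?_) x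
    rw [sum_abs_geomMatrix_row]
    refine (mul_le_mul_of_nonneg_left (hX i) (θ n).κ_nonneg).trans ?_
    have hγ := hr.γ_pos
    have hκ := (θ n).κ_nonneg
    rw [le_div_iff₀ (by positivity), lam₂]
    have hN : (0 : ℝ) ≤ ((2 * n : ℕ) : ℝ) := by positivity
    set N : ℝ := ((2 * n : ℕ) : ℝ)
    have h3 := mul_le_mul_of_nonneg_left hn hN
    have h4 : (1 + η) ^ 2 ≤ 1 + ε := by nlinarith
    have h5 : 0 ≤ (θ n).κ * N / (θ n).γ := by positivity
    calc (θ n).κ * ((1 + η) * (N / (2 * (θ n).γ))) * (4 * (1 + η))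
        = 2 * ((θ n).κ * N / (θ n).γ) * (1 + η) ^ 2 := by field_simp; ring
      _ ≤ 2 * ((θ n).κ * N / (θ n).γ) * (1 + ε) := by gcongr
      _ = N * (2 * (θ n).κ / (θ n).γ * (1 + ε)) := by ring
      _ ≤ _ := h3
      _ = _ := by ring
  · set R : ∀ n, Set (Positions (2 * n)) := fun n => {X | ∀ i,
      ∑ j, (if i = j then 0 else kernel (θ n).γ (X i) (X j)) ≤
        (1 + η) * ((2 * n : ℕ) / (2 * (θ n).γ))} with hR
    have hRm : ∀ n, MeasurableSet (R n) := by
      intro n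
      have : R n = ⋂ i, {X | ∑ j, (if i = j then 0 else kernel (θ n).γ (X i) (X j)) ≤
        (1 + η) * ((2 * n : ℕ) / (2 * (θ n).γ))} := by
        ext X; simp [hR]
      rw [this]
      refine MeasurableSet.iInter fun i => measurableSet_le ?_ measurable_const
      refine Finset.measurable_sum _ fun j _ => ?_
      split_ifs
      · exact measurable_const
      · fun_prop
    have hRc : Tendsto (fun n => positionLaw (2 * n) (R n)ᶜ) atTop (𝓝 0) := by
      simp_rw [fun n => prob_compl_eq_one_sub (μ := positionLaw (2 * n)) (hRm n)]
      have := ENNReal.Tendsto.sub (tendsto_const_nhds (x := (1 : ENNReal))) hrows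
        (Or.inl ENNReal.one_ne_top)
      rwa [tsub_self] at this
    -- Subadditivity with the complement of the measurable set `R n` avoids having to prove the
    -- event on `μ₁` measurable.
    have hlow := ENNReal.Tendsto.sub hsep hRc (Or.inl ENNReal.one_ne_top)
    rw [tsub_zero] at hlow
    refine tendsto_of_tendsto_of_tendsto_of_le_of_le' hlow tendsto_const_nhds ?_
      (Eventually.of_forall fun n => prob_le_one)
    filter_upwards [hreg] with n hr
    rw [tsub_le_iff_right]
    refine (measure_mono ?_).trans (measure_union_le _ _)
    intro X hX
    by_cases hXR : X ∈ R n
    · refine Or.inl ⟨hXR, fun x => ?_⟩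
      refine (abs_quad_le_topEigenvalue (geomMatrix_isHermitian _ _) (geomMatrix_nonneg _ _) x).trans
        (mul_le_mul_of_nonneg_right ?_ (dotProduct_self_nonneg_real x))
      rw [le_div_iff₀ (by positivity)]
      have hX' : lam₂ (2 * n) (θ n) ≥ 4 * topEigenvalue (geomMatrix (θ n) X) * (1 + ε) := hX
      have hl2 : 0 ≤ lam₂ (2 * n) (θ n) :=
        (mul_nonneg ha.le hr.lam₁_pos.le).trans hr.mul_lam₁_le
      rcases le_total 0 (topEigenvalue (geomMatrix (θ n) X)) with h | h
      · nlinarith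
      · exact (mul_nonpos_of_nonpos_of_nonneg h (by positivity)).trans hl2
    · exact Or.inr hXR

lemma degreesLE_edgeProb {N : ℕ} {θ : Params} {a η : ℝ} (hr : Regime N θ a) (hη : η ≤ 1)
    (c : Fin N → Bool) {X : Positions N} (hX : X ∈ goodPositions N θ η) :
    DegreesLE (edgeProb θ c X) (4 * lam₁ N θ) := by
  intro i
  have h1 : ∑ j, (if i = j then 0 else edgeProb θ c X i j) ≤
      ∑ j, (|geomMatrix θ X i j| + (θ.p₁ + θ.p₂)) := by
    refine Finset.sum_le_sum fun j _ => ?_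
    have := θ.p₁_pos
    have := θ.p₂_pos
    split_ifs with hij
    · positivity
    · refine add_le_add (le_abs_self _) ?_
      split_ifs <;> linarith
  refine h1.trans ?_
  rw [Finset.sum_add_distrib, sum_abs_geomMatrix_row]
  have h2 := mul_le_mul_of_nonneg_left (hX.1 i) θ.κ_nonneg
  have h3 : θ.κ * ((1 + η) * (N / (2 * θ.γ))) = (1 + η) * (θ.κ * N / (2 * θ.γ)) := by ring
  have h4 : 0 ≤ θ.κ * N / (2 * θ.γ) := by
    have := θ.κ_nonneg
    have := θ.γ_nonneg
    positivity
  have h5 := hr.κ_le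
  have h6 := hr.lam₂_le
  simp only [Finset.sum_const, Finset.card_univ, Fintype.card_fin, nsmul_eq_mul]
  have h7 : N * (θ.p₁ + θ.p₂) = 2 * lam₁ N θ := by rw [lam₁]; ring
  nlinarith

/-- Without noise `s ≥ 1 / 2 + η / (2 (1 + η))`; half of the surplus is given up to the noise. -/
lemma correlation_lower_bound {l η ρ τ s : ℝ} (hl : 0 < l) (hη : 0 < η)
    (hρ : ρ = l / (4 * (1 + η))) (hτ : τ ≤ η / (8 * (1 + η)) * l)
    (h : l - 2 * (ρ + τ) ≤ l * s) : 1 / 2 + 2 * (η / (8 * (1 + η))) ≤ s := by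
  refine le_of_mul_le_mul_left (le_trans ?_ h) hl
  have h1 : l * (1 / 2 + 2 * (η / (8 * (1 + η)))) =
      l - 2 * (l / (4 * (1 + η)) + η / (8 * (1 + η)) * l) := by
    field_simp
    ring
  rw [h1, hρ]
  linarith

lemma weaklyRecovers_of_graphProb_le {θ : ℕ → Params} {est : Estimator} {η δ : ℝ} (hδ : 0 < δ)
    (hgood : Tendsto (fun n => positionLaw (2 * n) (goodPositions (2 * n) (θ n) η)) atTop (𝓝 1))
    {ε : ℕ → ℝ} (hε : Tendsto ε atTop (𝓝 0))
    (h : ∀ᶠ n in atTop, ∀ (c : Fin (2 * n) → Bool), ∀ X ∈ goodPositions (2 * n) (θ n) η,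
      graphProb (edgeProb (θ n) c X)
        {G | IsNormalizedSignVec (est (2 * n) G (lam₁ (2 * n) (θ n))) ∧
          δ ≤ |communityVec c ⬝ᵥ est (2 * n) G (lam₁ (2 * n) (θ n))|}ᶜ ≤ ε n) :
    WeaklyRecovers est θ :=
  ⟨δ, hδ, fun c _ => tendsto_modelLaw (S := fun n =>
    {G | IsNormalizedSignVec (est (2 * n) G (lam₁ (2 * n) (θ n))) ∧
      δ ≤ |communityVec (c n) ⬝ᵥ est (2 * n) G (lam₁ (2 * n) (θ n))|}) hgood hε
    (h.mono fun n hn X hX => hn (c n) X hX)⟩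

/-! ### Recovery by an exhaustive search -/

lemma exists_max_quad {N : ℕ} (M : Matrix (Fin N) (Fin N) ℝ) :
    ∃ s : Fin N → Bool, ∀ c, quad M (communityVec c) ≤ quad M (communityVec s) :=
  Finite.exists_max fun s : Fin N → Bool => quad M (communityVec s)

/-- The community assignment that maximizes the quadratic form of `A - t v₁ v₁ᵀ`. -/
def searchEstimator : Estimator :=
  fun _ G t => communityVec (exists_max_quad (shiftedAdj G t)).choose

theorem weaklyRecovers_searchEstimator {θ : ℕ → Params} (h1 : H₁ θ) (h2 : H₂ θ)
    (hsep : ∃ ε > 0, Separated θ ε) : WeaklyRecovers searchEstimator θ := by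
  obtain ⟨η, hη0, hη1, hgood⟩ := exists_tendsto_goodPositions h1 h2 hsep
  obtain ⟨a, ha0, ha1, hreg⟩ := exists_regime h1 h2
  set b := η / (8 * (1 + η)) with hb
  have hb0 : 0 < b := by positivity
  have hb1 : b ≤ 1 := by rw [hb, div_le_one (by positivity)]; linarith
  refine weaklyRecovers_of_graphProb_le (η := η) (δ := 1 / 2) (by norm_num) hgood
    (ε := fun n => 2 * Real.exp (- ((2 * n : ℕ) : ℝ))) ?_ ?_
  · have := (Real.tendsto_exp_neg_atTop_nhds_zero.comp tendsto_two_mul_atTop).const_mul 2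
    simpa using this
  -- With `D = 4 λ₁` and `τ = b λ₂ ≥ b a λ₁`, this threshold gives `τ ^ 2 / (8 D) ≥ 2`, so the
  -- failure probability is at most `2 exp (-N)`.
  filter_upwards [hreg, (tendsto_lam₁ h1 h2).eventually_ge_atTop (64 / (b * a) ^ 2)]
    with n hr hlam c X hX
  have hl1 := hr.lam₁_pos
  have hl2 : 0 < lam₂ (2 * n) (θ n) := lt_of_lt_of_le (by positivity) hr.mul_lam₁_le
  have hp := isEdgeProb_edgeProb (θ n) c X
  refine (graphProb_mono hp ?_).trans ((noise_quad_sign_le hp (degreesLE_edgeProb hr hη1 c hX)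
    (by positivity) (τ := b * lam₂ (2 * n) (θ n)) (by positivity) ?_).trans ?_)
  · intro G hG
    by_contra hcon
    simp only [Set.mem_ofPred_eq, not_exists, not_le] at hcon
    apply hG
    set s := (exists_max_quad (shiftedAdj G (lam₁ (2 * n) (θ n)))).choose
    have hs := (exists_max_quad (shiftedAdj G (lam₁ (2 * n) (θ n)))).choose_spec c
    change IsNormalizedSignVec (communityVec s) ∧ 1 / 2 ≤ |communityVec c ⬝ᵥ communityVec s|
    refine ⟨isNormalizedSignVec_communityVec s, ?_⟩
    have hN : (0 : ℝ) < ((2 * n : ℕ) : ℝ) := by exact_mod_cast hr.N_pos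
    have hτ : ∀ s, |quad (noise (edgeProb (θ n) c X) G) (communityVec s)| ≤
        b * lam₂ (2 * n) (θ n) := by
      intro s
      rw [quad_communityVec, abs_div, abs_of_pos hN, div_le_iff₀ hN]
      exact (hcon s).le.trans (mul_comm _ _).le
    have h3 := correlation_lower_bound hl2 hη0 rfl le_rfl (correlation_of_quad_le hr.N_pos
      (communityVec_dotProduct_self hr.N_pos s) hX.2 (hτ s) (hτ c) hs)
    refine abs_le_of_sq_le_sq' ?_ (abs_nonneg _) |>.2
    rw [sq_abs]
    norm_num
    linarith
  · nlinarith [hr.lam₂_le]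
  · gcongr
    have h3 : (b * a) ^ 2 * lam₁ (2 * n) (θ n) ^ 2 ≤ (b * lam₂ (2 * n) (θ n)) ^ 2 := by
      rw [← mul_pow, mul_assoc]
      gcongr
      exact hr.mul_lam₁_le
    have h4 : 2 ≤ (b * lam₂ (2 * n) (θ n)) ^ 2 / (8 * (4 * lam₁ (2 * n) (θ n))) := by
      rw [le_div_iff₀ (by positivity)]
      rw [div_le_iff₀ (by positivity)] at hlam
      nlinarith
    have hN : (0 : ℝ) < ((2 * n : ℕ) : ℝ) := by exact_mod_cast hr.N_pos
    nlinarith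

/-! ### Recovery by the spectral estimator -/

lemma shiftedAdj_isHermitian {N : ℕ} (G : SimpleGraph (Fin N)) (t : ℝ) :
    (shiftedAdj G t).IsHermitian := by
  classical
  refine Matrix.IsHermitian.ext fun i j => ?_
  simp [shiftedAdj, Matrix.vecMulVec_apply, SimpleGraph.adjMatrix_apply, G.adj_comm i j]

theorem weaklyRecovers_of_isSpectralEstimator {est : Estimator} (hest : IsSpectralEstimator est)
    {θ : ℕ → Params} (h1 : H₁ θ) (h2 : H₂ θ) (hsep : ∃ ε > 0, Separated θ ε)
    (hlog : Tendsto (fun n => (θ n).κ * ((2 * n : ℕ) : ℝ) /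
        ((θ n).γ * Real.log ((2 * n : ℕ) : ℝ))) atTop atTop) : WeaklyRecovers est θ := by
  obtain ⟨η, hη0, hη1, hgood⟩ := exists_tendsto_goodPositions h1 h2 hsep
  obtain ⟨a, ha0, ha1, hreg⟩ := exists_regime h1 h2
  set b := η / (8 * (1 + η)) with hb
  have hb0 : 0 < b := by positivity
  -- First `k` makes the row-sum term at most `b a λ₁ / 2`; then `q`, depending on `k`, makes the
  -- discrepancy term equal to `b a λ₁ / 2`. Together they are at most `b λ₂`.
  obtain ⟨k, hk⟩ := exists_nat_gt (128 / (b * a))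
  have hk' : 64 / 2 ^ k ≤ b * a / 2 := by
    have : (k : ℝ) < 2 ^ k := by exact_mod_cast Nat.lt_two_pow_self
    rw [div_lt_iff₀ (by positivity)] at hk
    rw [div_le_iff₀ (by positivity)]
    nlinarith [mul_pos hb0 ha0]
  set q := b * a / (32 * (2 * k + 1)) with hq
  have hq0 : 0 < q := by positivity
  refine weaklyRecovers_of_graphProb_le (η := η) (δ := 4 * b) (by positivity) hgood
    (ε := fun n => (1 + 2 * Real.exp 2) / ((2 * n : ℕ) : ℝ)) ?_ ?_
  · exact tendsto_two_mul_atTop.const_div_atTop _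
  -- Through `λ₁ ≥ κ N / (2 γ)` the maximum gives both `λ₁ ≥ log N`, for the row sums, and `64 (4
  -- λ₁) log N ≤ (q λ₁) ^ 2`, for the discrepancy.
  filter_upwards [hreg, hlog.eventually_ge_atTop (2 * max 1 (256 / q ^ 2))] with n hr hlam c X hX
  have hl1 := hr.lam₁_pos
  have hl2 : 0 < lam₂ (2 * n) (θ n) := lt_of_lt_of_le (by positivity) hr.mul_lam₁_le
  have hp := isEdgeProb_edgeProb (θ n) c X
  have hN1 : (1 : ℝ) < ((2 * n : ℕ) : ℝ) := by
    have := hr.N_pos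
    exact_mod_cast (by omega : 1 < 2 * n)
  have hL : 0 < Real.log ((2 * n : ℕ) : ℝ) := Real.log_pos hN1
  have hγ := hr.γ_pos
  have hlam' : max 1 (256 / q ^ 2) * Real.log ((2 * n : ℕ) : ℝ) ≤ lam₁ (2 * n) (θ n) := by
    refine le_trans ?_ (hr.κ_le.trans hr.lam₂_le)
    rw [le_div_iff₀ (by positivity)] at hlam
    rw [le_div_iff₀ (by positivity)]
    linarith
  have hlam1 : Real.log ((2 * n : ℕ) : ℝ) ≤ lam₁ (2 * n) (θ n) := by
    nlinarith [le_max_left 1 (256 / q ^ 2)]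
  have hlam2 : 256 * Real.log ((2 * n : ℕ) : ℝ) ≤ q ^ 2 * lam₁ (2 * n) (θ n) := by
    have h3 : 256 / q ^ 2 * Real.log ((2 * n : ℕ) : ℝ) ≤ lam₁ (2 * n) (θ n) := by
      nlinarith [le_max_right 1 (256 / q ^ 2)]
    rw [div_mul_eq_mul_div, div_le_iff₀ (by positivity)] at h3
    linarith
  refine (graphProb_mono hp ?_).trans ((noise_quad_le hp (degreesLE_edgeProb hr hη1 c hX)
    (by positivity) (α := q * lam₁ (2 * n) (θ n)) (by positivity) hr.N_pos ?_ k).trans ?_)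
  · intro G hG
    by_contra hcon
    simp only [Set.mem_ofPred_eq, not_exists, not_lt] at hcon
    apply hG
    obtain ⟨x, hx, hx'⟩ := hest (2 * n) hr.N_pos G (lam₁ (2 * n) (θ n))
    change IsNormalizedSignVec _ ∧ _
    rw [hx']
    refine ⟨isNormalizedSignVec_signVec x, ?_⟩
    have hc1 := communityVec_dotProduct_self hr.N_pos c
    have hbound : 16 * (4 * lam₁ (2 * n) (θ n)) / 2 ^ k +
        16 * (2 * k + 1) * (q * lam₁ (2 * n) (θ n)) ≤ b * lam₂ (2 * n) (θ n) := by
      have h3 : 16 * (2 * k + 1) * (q * lam₁ (2 * n) (θ n)) = b * a / 2 * lam₁ (2 * n) (θ n) := by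
        rw [hq]; field_simp; ring
      have h4 : 16 * (4 * lam₁ (2 * n) (θ n)) / 2 ^ k = 64 / 2 ^ k * lam₁ (2 * n) (θ n) := by ring
      rw [h3, h4]
      calc _ ≤ b * a / 2 * lam₁ (2 * n) (θ n) + b * a / 2 * lam₁ (2 * n) (θ n) := by gcongr
        _ = b * (a * lam₁ (2 * n) (θ n)) := by ring
        _ ≤ _ := by gcongr; exact hr.mul_lam₁_le
    have hτ : ∀ y, y ⬝ᵥ y = 1 → |quad (noise (edgeProb (θ n) c X) G) y| ≤
        b * lam₂ (2 * n) (θ n) := by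
      intro y hy
      have := hcon y
      rw [hy, mul_one] at this
      exact this.trans hbound
    have hle : quad (shiftedAdj G (lam₁ (2 * n) (θ n))) (communityVec c) ≤
        quad (shiftedAdj G (lam₁ (2 * n) (θ n))) x := by
      rw [quad_of_isTopUnitEigenvector hx]
      have := quad_le_topEigenvalue (shiftedAdj_isHermitian G (lam₁ (2 * n) (θ n)))
        (communityVec c)
      rwa [hc1, mul_one] at this
    have h3 := correlation_lower_bound hl2 hη0 rfl le_rfl (correlation_of_quad_le hr.N_pos
      hx.1 hX.2 (hτ x hx.1) (hτ _ hc1) hle)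
    refine le_trans ?_ (correlation_signVec hr.N_pos c hx.1)
    linarith
  · nlinarith
  · rw [add_div]
    gcongr
    set N : ℝ := ((2 * n : ℕ) : ℝ)
    calc N * Real.exp (-(4 * lam₁ (2 * n) (θ n) / 2)) ≤ N * Real.exp (-(2 * Real.log N)) := by
          gcongr
          linarith
      _ = 1 / N := by
          have hN0 : 0 < N := by linarith
          rw [Real.exp_neg, mul_comm (2 : ℝ), Real.exp_mul, Real.exp_log hN0, Real.rpow_two]
          field_simp

end PerturbedSBM

end

open PerturbedSBM in
theorem theorem1 :
    (∃ est : Estimator, ∀ θ : ℕ → Params, H₁ θ → H₂ θ → (∃ ε > 0, Separated θ ε) →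
      WeaklyRecovers est θ) ∧
    (∀ est : Estimator, IsSpectralEstimator est →
      ∀ θ : ℕ → Params, H₁ θ → H₂ θ → (∃ ε > 0, Separated θ ε) →
      Tendsto (fun n => (θ n).κ * ((2 * n : ℕ) : ℝ) /
        ((θ n).γ * Real.log ((2 * n : ℕ) : ℝ))) atTop atTop →
      WeaklyRecovers est θ) :=
  ⟨⟨searchEstimator, fun _ h1 h2 hsep => weaklyRecovers_searchEstimator h1 h2 hsep⟩,
    fun _ hest _ h1 h2 hsep hlog => weaklyRecovers_of_isSpectralEstimator hest h1 h2 hsep hlog⟩
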